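/- Let \(1<p<\infty\), \(0<s<1\), \(N>sp\), and let \(\Omega\subset\mathbb R^N\) be a smooth bounded domain. Let \(\gamma>0\) and let \(f\in L^1(\Omega)\) be non-negative. Notation. \(W^{s,p}_0(\Omega)\) is the space of all \(w\in L^p(\mathbb R^N)\) with \(w=0\) a.e. in \(\mathbb R^N\setminus\Omega\) and \[ \int_{\mathbb R^{2N}}\frac{|w(x)-w(y)|^p}{|x-y|^{N+sp}}\,dx\,dy<\infty , \] and \(W^{s,p}_{\rm loc}(\Omega)\) is the space of functions \(w\) such that \(w\in L^p(K)\) and \(\int_{K\times K}\frac{|w(x)-w(y)|^p}{|x-y|^{N+sp}}\,dx\,dy<\infty\) for every compact \(K\subset\Omega\). A measurable function \(z:\mathbb R^N\to\mathbb R\) with \(z\ge0\) a.e. and \(z\in W^{s,p}_{\rm loc}(\Omega)\cap L^{p-1}(\Omega)\) is a weak supersolution (respectively, subsolution) of the singular problem \((-\Delta)^s_p z=f/z^\gamma\) in \(\Omega\) if \(f/z^\gamma\in L^1_{\rm loc}(\Omega)\) (where \(f/z^\gamma\) is read as \(+\infty\) where \(z=0<f\), and as \(0\) where \(f=0\)) and,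 for every \(\varphi\in C^\infty_c(\Omega)\) with \(\varphi\ge0\), the integral on the left-hand side below converges absolutely (which is automatic if \(z=0\) a.e. in \(\mathbb R^N\setminus\Omega\)) and \[ \int_{\mathbb R^{2N}}\frac{|z(x)-z(y)|^{p-2}(z(x)-z(y))(\varphi(x)-\varphi(y))}{|x-y|^{N+sp}}\,dx\,dy\ \ge\ \int_\Omega \frac{f}{z^\gamma}\,\varphi\,dx \qquad(\text{respectively, }\le). \] For a function \(u\) with \(u=0\) a.e. in \(\mathbb R^N\setminus\Omega\), we say that \(u\le0\) on \(\partial\Omega\) if \((u-\varepsilon)^+\in W^{s,p}_0(\Omega)\) for every \(\varepsilon>0\). Theorem (weak comparison principle). Let \(u\) be a weak subsolution such that \(u=0\) a.e. in \(\mathbb R^N\setminus\Omega\) and \(u\le 0\) on \(\partial\Omega\), and let \(v\) be a weak supersolution. Then \(u\le v\) a.e. in \(\Omega\). -/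

import Mathlib

open MeasureTheory Set
open scoped ENNReal ContDiff

namespace FracPLap

/-- `Ω` is a smooth bounded domain of `ℝ^N`: open, connected, bounded, and near each of its boundary
points it is the region `{ρ < 0}` for some smooth `ρ` whose differential does not vanish there. -/
structure IsSmoothBoundedDomain {N : ℕ} (Ω : Set (EuclideanSpace ℝ (Fin N))) : Prop where
  isOpen : IsOpen Ω
  isConnected : IsConnected Ω
  isBounded : Bornology.IsBounded Ω
  smooth_boundary : ∀ x₀ ∈ frontier Ω, ∃ (U : Set (EuclideanSpace ℝ (Fin N)))
    (ρ : EuclideanSpace ℝ (Fin N) → ℝ), IsOpen U ∧ x₀ ∈ U ∧ ContDiff ℝ ∞ ρ ∧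
      fderiv ℝ ρ x₀ ≠ 0 ∧ Ω ∩ U = {x ∈ U | ρ x < 0}

/-- The `p`-th power of the Gagliardo seminorm of `u` on `A`,
`∬_{A × A} |u(x) - u(y)|^p / |x - y|^{N + s p} dx dy`, with values in `[0, ∞]`. -/
noncomputable def gagliardo {N : ℕ} (s p : ℝ) (A : Set (EuclideanSpace ℝ (Fin N)))
    (u : EuclideanSpace ℝ (Fin N) → ℝ) : ℝ≥0∞ :=
  ∫⁻ q : EuclideanSpace ℝ (Fin N) × EuclideanSpace ℝ (Fin N) in A ×ˢ A,
    ENNReal.ofReal (|u q.1 - u q.2| ^ p / ‖q.1 - q.2‖ ^ ((N : ℝ) + s * p))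

/-- `u ∈ W^{s,p}_0(Ω)`: `u ∈ L^p(ℝ^N)`, the Gagliardo seminorm of `u` on `ℝ^N` is finite, and
`u = 0` a.e. in `ℝ^N \ Ω`. -/
structure MemW0 {N : ℕ} (s p : ℝ) (Ω : Set (EuclideanSpace ℝ (Fin N)))
    (u : EuclideanSpace ℝ (Fin N) → ℝ) : Prop where
  memLp : MemLp u (ENNReal.ofReal p) volume
  gagliardo_lt_top : gagliardo s p univ u < ⊤
  ae_eq_zero : ∀ᵐ x, x ∉ Ω → u x = 0

/-- `u ∈ W^{s,p}_loc(Ω)`: for every compact `K ⊆ Ω`, `u ∈ L^p(K)` and the Gagliardo seminorm of `u`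
on `K` is finite. -/
def MemWloc {N : ℕ} (s p : ℝ) (Ω : Set (EuclideanSpace ℝ (Fin N)))
    (u : EuclideanSpace ℝ (Fin N) → ℝ) : Prop :=
  ∀ K : Set (EuclideanSpace ℝ (Fin N)), IsCompact K → K ⊆ Ω →
    MemLp u (ENNReal.ofReal p) (volume.restrict K) ∧ gagliardo s p K u < ⊤

/-- `u ≤ 0` on `∂Ω`: `u = 0` a.e. in `ℝ^N \ Ω`, and `(u - ε)⁺ ∈ W^{s,p}_0(Ω)` for every `ε > 0`. -/
def NonposOnBoundary {N : ℕ} (s p : ℝ) (Ω : Set (EuclideanSpace ℝ (Fin N)))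
    (u : EuclideanSpace ℝ (Fin N) → ℝ) : Prop :=
  (∀ᵐ x, x ∉ Ω → u x = 0) ∧ ∀ ε : ℝ, 0 < ε → MemW0 s p Ω (fun x => max (u x - ε) 0)

/-- `φ ∈ C^∞_c(Ω)` and `φ ≥ 0`. -/
structure IsNonnegTest {N : ℕ} (Ω : Set (EuclideanSpace ℝ (Fin N)))
    (φ : EuclideanSpace ℝ (Fin N) → ℝ) : Prop where
  contDiff : ContDiff ℝ ∞ φ
  hasCompactSupport : HasCompactSupport φ
  tsupport_subset : tsupport φ ⊆ Ω
  nonneg : ∀ x, 0 ≤ φ x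

/-- The integrand
`|z(x) - z(y)|^{p-2} (z(x) - z(y)) (φ(x) - φ(y)) / |x - y|^{N + s p}` at `q = (x, y)`. -/
noncomputable def formIntegrand {N : ℕ} (s p : ℝ) (z φ : EuclideanSpace ℝ (Fin N) → ℝ)
    (q : EuclideanSpace ℝ (Fin N) × EuclideanSpace ℝ (Fin N)) : ℝ :=
  |z q.1 - z q.2| ^ (p - 2) * (z q.1 - z q.2) * (φ q.1 - φ q.2) /
    ‖q.1 - q.2‖ ^ ((N : ℝ) + s * p)

/-- The function `f / z^γ` for nonnegative `f` and `z`, with values in `[0, ∞]`: it is `∞` where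
`z = 0 < f`, and `0` where `f = 0`. -/
noncomputable def singularTerm {N : ℕ} (γ : ℝ) (f z : EuclideanSpace ℝ (Fin N) → ℝ)
    (x : EuclideanSpace ℝ (Fin N)) : ℝ≥0∞ :=
  ENNReal.ofReal (f x) / ENNReal.ofReal (z x) ^ γ

/-- What weak subsolutions and weak supersolutions have in common: `z ≥ 0`,
`z ∈ W^{s,p}_loc(Ω) ∩ L^{p-1}(Ω)`, `f / z^γ ∈ L^1_loc(Ω)`, and the double integral in the weak
formulation converges absolutely (which is automatic if `z` vanishes outside `Ω`). -/
structure IsAdmissible {N : ℕ} (s p γ : ℝ) (Ω : Set (EuclideanSpace ℝ (Fin N)))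
    (f z : EuclideanSpace ℝ (Fin N) → ℝ) : Prop where
  aemeasurable : AEMeasurable z volume
  nonneg : ∀ᵐ x, 0 ≤ z x
  memWloc : MemWloc s p Ω z
  memLp : MemLp z (ENNReal.ofReal (p - 1)) (volume.restrict Ω)
  locallyIntegrable_singularTerm : ∀ K : Set (EuclideanSpace ℝ (Fin N)), IsCompact K → K ⊆ Ω →
    ∫⁻ x in K, singularTerm γ f z x < ⊤
  integrable_form : ∀ φ, IsNonnegTest Ω φ → Integrable (formIntegrand s p z φ) volume

/-- `z` is a weak subsolution of `(-Δ)_p^s z = f / z^γ` in `Ω`. -/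
def IsWeakSubsolution {N : ℕ} (s p γ : ℝ) (Ω : Set (EuclideanSpace ℝ (Fin N)))
    (f z : EuclideanSpace ℝ (Fin N) → ℝ) : Prop :=
  IsAdmissible s p γ Ω f z ∧ ∀ φ, IsNonnegTest Ω φ →
    ∫ q, formIntegrand s p z φ q ≤ ∫ x in Ω, (singularTerm γ f z x).toReal * φ x

/-- `z` is a weak supersolution of `(-Δ)_p^s z = f / z^γ` in `Ω`. -/
def IsWeakSupersolution {N : ℕ} (s p γ : ℝ) (Ω : Set (EuclideanSpace ℝ (Fin N)))
    (f z : EuclideanSpace ℝ (Fin N) → ℝ) : Prop :=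
  IsAdmissible s p γ Ω f z ∧ ∀ φ, IsNonnegTest Ω φ →
    ∫ x in Ω, (singularTerm γ f z x).toReal * φ x ≤ ∫ q, formIntegrand s p z φ q

end FracPLap

/-! Write `J(t) = |t|^{p-2} t`, let `ν` be the measure `|x-y|^{-(N+sp)} dx dy`, and put `w = (u -
ε)⁺`. Formally, both inequalities are tested with `(w - v)⁺`. Where this function is positive, `u >
v + ε`, hence `f / u^γ ≤ f / v^γ`, and replacing `u` by `w` only lowers the form. Subtracting, the
integral against `ν` of `J(w(x)-w(y)) - J(v(x)-v(y))` times the increment of `(w - v)⁺` is at most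
`0`. Since `J` is increasing, this integrand is nonnegative, so it vanishes a.e. For `x ∈ Ω` with
`w(x) > v(x)` and `y ∉ Ω` it is strictly positive, because `w(y) = 0 ≤ v(y)`; as `Ωᶜ` has positive
measure, `w ≤ v` a.e. in `Ω`. Then `ε → 0`.

The obstacle is that `(w - v)⁺` need be neither bounded nor compactly supported in `Ω`, and that `v`
has only a local seminorm. So `w` is replaced by `w_n = η_n min(w, n)`, with `η_n` a cutoff
vanishing near the boundary, and the test function is `ψ_n = (w_n - v)⁺`. It has finite seminorm
(`gagliardo_posPart_sub_lt_top`) and is a limit of smooth test functions along which both sides of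
the weak formulation converge (`IsAdmissible.exists_nonnegTest_seq`). This yields `∬ J(w) ψ_n ≤ ∬
J(v) ψ_n`, abbreviating increments (`integral_form_cut_le`).

The mismatch between `w` and `w_n` is absorbed in `ae_signedPow_sub_mul_nonpos`. By Hölder it costs
a vanishing factor times the seminorm of `ψ_n`, and `signedPow_coercive` bounds that seminorm by the
monotone quantity plus the seminorm of `w_n`, with no global information on `v`. The factor vanishes
because the increments of all `w_n` share an `L^p(ν)` majorant (`memLp_truncationBound`), which
rests on the fractional Hardy inequality `lintegral_hardy`, itself a consequence of exterior balls
for the smooth domain. -/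

namespace FracPLap

open Filter Topology
open scoped Manifold

variable {N : ℕ}

/-! ### Monotonicity and coercivity of `|t|^{p-2} t`. -/

/-- The monotone function `t ↦ |t|^{p-2} t`. -/
noncomputable def signedPow (p t : ℝ) : ℝ := |t| ^ (p - 2) * t

lemma signedPow_of_nonneg {p t : ℝ} (hp : 1 < p) (ht : 0 ≤ t) : signedPow p t = t ^ (p - 1) := by
  rcases ht.eq_or_lt with rfl | ht
  · simp [signedPow, Real.zero_rpow (by linarith : p - 1 ≠ 0)]
  · rw [signedPow, abs_of_pos ht, ← Real.rpow_add_one ht.ne']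
    congr 1; ring

lemma signedPow_neg (p t : ℝ) : signedPow p (-t) = -signedPow p t := by
  simp [signedPow]

lemma signedPow_eq {p : ℝ} (hp : 1 < p) (t : ℝ) :
    signedPow p t = max t 0 ^ (p - 1) - max (-t) 0 ^ (p - 1) := by
  have h0 : (0 : ℝ) ^ (p - 1) = 0 := Real.zero_rpow (by linarith)
  rcases le_total 0 t with ht | ht
  · rw [signedPow_of_nonneg hp ht, max_eq_left ht, max_eq_right (by linarith), h0, sub_zero]
  · rw [← neg_neg t, signedPow_neg, signedPow_of_nonneg hp (by linarith : 0 ≤ -t), neg_neg t,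
      max_eq_right ht, max_eq_left (by linarith), h0, zero_sub]

lemma continuous_signedPow {p : ℝ} (hp : 1 < p) : Continuous (signedPow p) := by
  have : signedPow p = fun t => max t 0 ^ (p - 1) - max (-t) 0 ^ (p - 1) :=
    funext (signedPow_eq hp)
  rw [this]
  refine Continuous.sub ?_ ?_ <;>
  · refine Continuous.rpow_const (by fun_prop) fun _ => Or.inr (by linarith)

lemma signedPow_strictMono {p : ℝ} (hp : 1 < p) : StrictMono (signedPow p) := by
  refine strictMono_of_odd_strictMonoOn_nonneg (signedPow_neg p) ?_
  intro a ha b hb hab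
  rw [signedPow_of_nonneg hp ha, signedPow_of_nonneg hp hb]
  exact Real.rpow_lt_rpow ha hab (by linarith)

lemma abs_signedPow {p : ℝ} (hp : 1 < p) (t : ℝ) : |signedPow p t| = |t| ^ (p - 1) := by
  rw [signedPow, abs_mul, abs_of_nonneg (Real.rpow_nonneg (abs_nonneg t) _)]
  rcases eq_or_ne t 0 with rfl | ht
  · simp [Real.zero_rpow (by linarith : p - 1 ≠ 0)]
  · rw [← Real.rpow_add_one (abs_pos.2 ht).ne']
    congr 1; ring

/-- Increments `t` between `0` and `a - b` are controlled by the monotonicity of `signedPow`. -/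
lemma signedPow_coercive_of_nonneg {p a b t : ℝ} (hp : 1 < p) (ht : 0 ≤ t) (hab : t ≤ a - b) :
    t ^ p ≤ (4 ^ p + ((3 / 4) ^ (p - 1) - (1 / 4) ^ (p - 1))⁻¹) *
      ((signedPow p a - signedPow p b) * t + |a| ^ p) := by
  have hc : 0 < ((3 / 4 : ℝ) ^ (p - 1) - (1 / 4) ^ (p - 1)) :=
    sub_pos.2 (Real.rpow_lt_rpow (by norm_num) (by norm_num) (by linarith))
  set c := ((3 / 4 : ℝ) ^ (p - 1) - (1 / 4) ^ (p - 1))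
  have hm : 0 ≤ (signedPow p a - signedPow p b) * t :=
    mul_nonneg (sub_nonneg.2 ((signedPow_strictMono hp).monotone (by linarith))) ht
  have ha : 0 ≤ |a| ^ p := Real.rpow_nonneg (abs_nonneg a) _
  have h4 : (0 : ℝ) ≤ 4 ^ p := by positivity
  have hci : 0 ≤ c⁻¹ := by positivity
  -- If `t ≤ 4|a|`, the term `|a|^p` suffices. Otherwise `a ≥ -t/4` and `b ≤ a - t ≤ -3t/4`, so the
  -- values of `signedPow` differ by at least `c t^{p-1}`. No size bound on `b` enters.
  rcases le_or_gt t (4 * |a|) with h | h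
  · calc t ^ p ≤ (4 * |a|) ^ p := Real.rpow_le_rpow ht h (by linarith)
      _ = 4 ^ p * |a| ^ p := Real.mul_rpow (by norm_num) (abs_nonneg a)
      _ ≤ _ := by nlinarith [mul_nonneg hci hm, mul_nonneg hci ha, mul_nonneg h4 hm]
  · have htpos : 0 < t := lt_of_le_of_lt (by positivity) h
    have hb : signedPow p b ≤ -((3 / 4) ^ (p - 1) * t ^ (p - 1)) := by
      rw [← Real.mul_rpow (by norm_num) ht, ← signedPow_of_nonneg hp (by positivity),
        ← signedPow_neg]
      refine (signedPow_strictMono hp).monotone ?_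
      have := le_abs_self a
      linarith
    have ha' : -((1 / 4) ^ (p - 1) * t ^ (p - 1)) ≤ signedPow p a := by
      rw [← Real.mul_rpow (by norm_num) ht, ← signedPow_of_nonneg hp (by positivity),
        ← signedPow_neg]
      refine (signedPow_strictMono hp).monotone ?_
      have := neg_abs_le a
      linarith
    have hd : c * t ^ (p - 1) ≤ signedPow p a - signedPow p b := by
      simp only [c]; linarith
    have htp : t ^ p = t ^ (p - 1) * t := by
      rw [← Real.rpow_add_one htpos.ne']; congr 1; ring
    calc t ^ p = c⁻¹ * (c * t ^ (p - 1) * t) := by rw [htp]; field_simp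
      _ ≤ c⁻¹ * ((signedPow p a - signedPow p b) * t) := by gcongr
      _ ≤ _ := by nlinarith [mul_nonneg hci hm, mul_nonneg hci ha, mul_nonneg h4 hm,
                    mul_nonneg h4 ha]

/-- The increments of the positive part of the difference of two functions are controlled by the
monotonicity of `signedPow`. -/
lemma signedPow_coercive {p : ℝ} (hp : 1 < p) : ∃ C : ℝ, 0 < C ∧ ∀ x y x' y' : ℝ,
    0 ≤ (signedPow p (x - y) - signedPow p (x' - y')) * (max (x - x') 0 - max (y - y') 0) ∧
    |max (x - x') 0 - max (y - y') 0| ^ p ≤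
      C * ((signedPow p (x - y) - signedPow p (x' - y')) * (max (x - x') 0 - max (y - y') 0)
        + |x - y| ^ p) := by
  have hc : 0 < ((3 / 4 : ℝ) ^ (p - 1) - (1 / 4) ^ (p - 1)) :=
    sub_pos.2 (Real.rpow_lt_rpow (by norm_num) (by norm_num) (by linarith))
  refine ⟨4 ^ p + ((3 / 4) ^ (p - 1) - (1 / 4) ^ (p - 1))⁻¹, by positivity, ?_⟩
  -- The second alternative covers the case where both positive parts vanish: the increment of the
  -- full difference may then be negative.
  have key : ∀ x y x' y' : ℝ, max (y - y') 0 ≤ max (x - x') 0 →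
      max (x - x') 0 - max (y - y') 0 ≤ (x - y) - (x' - y') ∨
      max (x - x') 0 - max (y - y') 0 = 0 := by
    intro x y x' y' h
    rcases le_total (x - x') 0 with h1 | h1 <;> rcases le_total (y - y') 0 with h2 | h2 <;>
      simp only [h1, h2, max_eq_left, max_eq_right] at h ⊢ <;>
      first | (left; linarith) | (right; linarith)
  have main : ∀ x y x' y' : ℝ, max (y - y') 0 ≤ max (x - x') 0 →
      0 ≤ (signedPow p (x - y) - signedPow p (x' - y')) * (max (x - x') 0 - max (y - y') 0) ∧
      |max (x - x') 0 - max (y - y') 0| ^ p ≤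
        (4 ^ p + ((3 / 4) ^ (p - 1) - (1 / 4) ^ (p - 1))⁻¹) *
        ((signedPow p (x - y) - signedPow p (x' - y')) * (max (x - x') 0 - max (y - y') 0)
        + |x - y| ^ p) := by
    intro x y x' y' h
    have ht : 0 ≤ max (x - x') 0 - max (y - y') 0 := sub_nonneg.2 h
    rcases key x y x' y' h with hk | hk
    · refine ⟨mul_nonneg (sub_nonneg.2 ((signedPow_strictMono hp).monotone (by linarith))) ht, ?_⟩
      rw [abs_of_nonneg ht]
      exact signedPow_coercive_of_nonneg hp ht hk
    · rw [hk]
      simp only [mul_zero, abs_zero, le_refl, zero_add, true_and]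
      rw [Real.zero_rpow (by linarith)]
      positivity
  intro x y x' y'
  rcases le_total (max (y - y') 0) (max (x - x') 0) with h | h
  · exact main x y x' y' h
  -- Exchanging the two points changes the sign of every increment, and `signedPow` is odd, so all
  -- terms are unchanged.
  · have := main y x y' x' h
    rw [← neg_sub x y, ← neg_sub x' y', signedPow_neg, signedPow_neg, abs_neg,
      ← neg_sub (max (x - x') 0), abs_neg] at this
    have e : ∀ A B t : ℝ, (-A - -B) * -t = (A - B) * t := fun A B t => by ring
    rwa [e] at this

/-! ### The seminorm and the form as integrals against the kernel measure. -/

/-- The increment `u(x) - u(y)` at `q = (x, y)`. -/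
def increment (u : EuclideanSpace ℝ (Fin N) → ℝ)
    (q : EuclideanSpace ℝ (Fin N) × EuclideanSpace ℝ (Fin N)) : ℝ := u q.1 - u q.2

/-- The kernel `|x - y|^{-(N + s p)}`. -/
noncomputable def kernel (s p : ℝ)
    (q : EuclideanSpace ℝ (Fin N) × EuclideanSpace ℝ (Fin N)) : ℝ :=
  (‖q.1 - q.2‖ ^ ((N : ℝ) + s * p))⁻¹

/-- The measure `|x - y|^{-(N + s p)} dx dy`. -/
noncomputable def kernelMeasure (N : ℕ) (s p : ℝ) :
    Measure (EuclideanSpace ℝ (Fin N) × EuclideanSpace ℝ (Fin N)) :=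
  volume.withDensity fun q => ENNReal.ofReal (kernel s p q)

lemma kernel_nonneg (s p : ℝ) (q : EuclideanSpace ℝ (Fin N) × EuclideanSpace ℝ (Fin N)) :
    0 ≤ kernel s p q := by unfold kernel; positivity

lemma measurable_kernel (s p : ℝ) : Measurable (kernel (N := N) s p) := by
  unfold kernel; fun_prop

lemma measurable_increment {u : EuclideanSpace ℝ (Fin N) → ℝ} (hu : Measurable u) :
    Measurable (increment u) := by
  unfold increment; fun_prop

lemma kernelMeasure_absolutelyContinuous (s p : ℝ) : kernelMeasure N s p ≪ volume :=
  withDensity_absolutelyContinuous _ _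

lemma lintegral_kernelMeasure (s p : ℝ)
    {F : EuclideanSpace ℝ (Fin N) × EuclideanSpace ℝ (Fin N) → ℝ≥0∞} (hF : Measurable F) :
    ∫⁻ q, F q ∂kernelMeasure N s p = ∫⁻ q, ENNReal.ofReal (kernel s p q) * F q :=
  lintegral_withDensity_eq_lintegral_mul _ (measurable_kernel s p).ennreal_ofReal hF

lemma enorm_rpow_eq_ofReal {p : ℝ} (hp : 0 < p) (t : ℝ) :
    ‖t‖ₑ ^ p = ENNReal.ofReal (|t| ^ p) := by
  rw [Real.enorm_eq_ofReal_abs, ENNReal.ofReal_rpow_of_nonneg (abs_nonneg t) hp.le]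

/-- With the kernel absorbed in the measure, the seminorm is an `L^p` norm of increments, so that
Hölder, domination and Fatou apply directly. -/
lemma gagliardo_eq {s p : ℝ} (hp : 0 < p) {A : Set (EuclideanSpace ℝ (Fin N))}
    (hA : MeasurableSet A) {u : EuclideanSpace ℝ (Fin N) → ℝ} (hu : Measurable u) :
    gagliardo s p A u = ∫⁻ q in A ×ˢ A, ‖increment u q‖ₑ ^ p ∂kernelMeasure N s p := by
  rw [kernelMeasure, restrict_withDensity (hA.prod hA),
    lintegral_withDensity_eq_lintegral_mul _ (measurable_kernel s p).ennreal_ofReal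
      ((measurable_increment hu).enorm.pow_const p), gagliardo]
  refine lintegral_congr fun q => ?_
  rw [Pi.mul_apply, enorm_rpow_eq_ofReal hp, ← ENNReal.ofReal_mul (kernel_nonneg s p q), kernel,
    increment, div_eq_mul_inv, mul_comm]

lemma memLp_ofReal_iff {α : Type*} [MeasurableSpace α] {μ : Measure α} {p : ℝ} (hp : 0 < p)
    {F : α → ℝ} (hF : AEStronglyMeasurable F μ) :
    MemLp F (ENNReal.ofReal p) μ ↔ ∫⁻ q, ‖F q‖ₑ ^ p ∂μ < ⊤ := by
  have h := eLpNorm_lt_top_iff_lintegral_rpow_enorm_lt_top (f := F) (μ := μ)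
    (ENNReal.ofReal_pos.2 hp).ne' ENNReal.ofReal_ne_top
  rw [ENNReal.toReal_ofReal hp.le] at h
  rw [← h]
  exact ⟨fun h => h.2, fun h => ⟨hF, h⟩⟩

lemma memLp_increment_iff {s p : ℝ} (hp : 0 < p) {A : Set (EuclideanSpace ℝ (Fin N))}
    (hA : MeasurableSet A) {u : EuclideanSpace ℝ (Fin N) → ℝ} (hu : Measurable u) :
    MemLp (increment u) (ENNReal.ofReal p) ((kernelMeasure N s p).restrict (A ×ˢ A)) ↔
      gagliardo s p A u < ⊤ := by
  rw [gagliardo_eq hp hA hu,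
    memLp_ofReal_iff hp (measurable_increment hu).aestronglyMeasurable]

lemma formIntegrand_eq (s p : ℝ) (z φ : EuclideanSpace ℝ (Fin N) → ℝ)
    (q : EuclideanSpace ℝ (Fin N) × EuclideanSpace ℝ (Fin N)) :
    formIntegrand s p z φ q =
      (ENNReal.ofReal (kernel s p q)).toReal • (signedPow p (increment z q) * increment φ q) := by
  rw [ENNReal.toReal_ofReal (kernel_nonneg s p q), formIntegrand, signedPow, increment, increment,
    kernel, smul_eq_mul]
  ring

lemma integral_formIntegrand (s p : ℝ) (z φ : EuclideanSpace ℝ (Fin N) → ℝ) :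
    ∫ q, formIntegrand s p z φ q =
      ∫ q, signedPow p (increment z q) * increment φ q ∂kernelMeasure N s p := by
  rw [kernelMeasure, integral_withDensity_eq_integral_toReal_smul
    (measurable_kernel s p).ennreal_ofReal (Eventually.of_forall fun _ => ENNReal.ofReal_lt_top)]
  exact integral_congr_ae (Eventually.of_forall fun q => formIntegrand_eq s p z φ q)

lemma integrable_formIntegrand_iff (s p : ℝ) (z φ : EuclideanSpace ℝ (Fin N) → ℝ) :
    Integrable (formIntegrand s p z φ) ↔
      Integrable (fun q => signedPow p (increment z q) * increment φ q) (kernelMeasure N s p) := by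
  rw [kernelMeasure, integrable_withDensity_iff_integrable_smul'
    (measurable_kernel s p).ennreal_ofReal (Eventually.of_forall fun _ => ENNReal.ofReal_lt_top)]
  exact integrable_congr (Eventually.of_forall fun q => formIntegrand_eq s p z φ q)

/-! ### Tempered kernels and the fractional Hardy inequality. -/

/-- Near `0` the profile behaves like `r^{p-1-sp}`, integrable because `s < 1`; at infinity like
`r^{-1-sp}`, integrable because `s > 0`. -/
lemma integrableOn_radial_profile {n : ℕ} (hn : 0 < n) {s p : ℝ} (hs0 : 0 < s) (hs1 : s < 1)
    (hp : 1 < p) :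
    IntegrableOn (fun r : ℝ => r ^ (n - 1) • ((min 1 (2 * r)) ^ p * (r ^ ((n : ℝ) + s * p))⁻¹))
      (Ioi 0) := by
  have hsp : 0 < s * p := by positivity
  have hsp' : s * p < p := by nlinarith
  have hm : Measurable
      (fun r : ℝ => r ^ (n - 1) • ((min 1 (2 * r)) ^ p * (r ^ ((n : ℝ) + s * p))⁻¹)) := by
    simp only [smul_eq_mul]; fun_prop
  have hpow : ∀ r : ℝ, 0 < r → r ^ (n - 1) * (r ^ ((n : ℝ) + s * p))⁻¹ = r ^ (-1 - s * p) := by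
    intro r hr
    rw [← Real.rpow_natCast, ← Real.rpow_neg hr.le, ← Real.rpow_add hr, Nat.cast_sub hn]
    congr 1; push_cast; ring
  rw [← Ioc_union_Ioi_eq_Ioi (zero_le_one' ℝ)]
  refine IntegrableOn.union ?_ ?_
  · have h1 : IntegrableOn (fun r : ℝ => 2 ^ p * r ^ (p - 1 - s * p)) (Ioc 0 1) := by
      refine Integrable.const_mul ?_ _
      exact (intervalIntegrable_iff_integrableOn_Ioc_of_le zero_le_one).1
        (intervalIntegral.intervalIntegrable_rpow' (by linarith))
    refine h1.mono' hm.aestronglyMeasurable ?_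
    filter_upwards [ae_restrict_mem measurableSet_Ioc] with r hr
    have hr0 : 0 < r := hr.1
    have hmin : 0 ≤ min 1 (2 * r) := by positivity
    rw [smul_eq_mul, Real.norm_of_nonneg (by positivity)]
    calc r ^ (n - 1) * ((min 1 (2 * r)) ^ p * (r ^ ((n : ℝ) + s * p))⁻¹)
        = (min 1 (2 * r)) ^ p * (r ^ (n - 1) * (r ^ ((n : ℝ) + s * p))⁻¹) := by ring
      _ ≤ (2 * r) ^ p * r ^ (-1 - s * p) := by
          rw [hpow r hr0]
          gcongr
          exact min_le_right _ _
      _ = 2 ^ p * r ^ (p - 1 - s * p) := by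
          rw [Real.mul_rpow (by norm_num) hr0.le, mul_assoc, ← Real.rpow_add hr0]
          congr 2; ring
  · have h1 : IntegrableOn (fun r : ℝ => r ^ (-1 - s * p)) (Ioi 1) :=
      integrableOn_Ioi_rpow_of_lt (by linarith) zero_lt_one
    refine h1.mono' hm.aestronglyMeasurable ?_
    filter_upwards [ae_restrict_mem measurableSet_Ioi] with r hr
    have hr1 : 1 < r := hr
    have hr0 : 0 < r := by linarith
    rw [smul_eq_mul, Real.norm_of_nonneg (by positivity), min_eq_left (by linarith),
      Real.one_rpow, one_mul, hpow r hr0]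

/-- The kernel tempered by `min(1, 2|x - y|/d)^p` has integral of order `d^{-s p}`. -/
lemma lintegral_tempered_kernel_le (hN : 0 < N) {s p : ℝ} (hs0 : 0 < s) (hs1 : s < 1)
    (hp : 1 < p) : ∃ C : ℝ≥0∞, C ≠ ⊤ ∧ ∀ (y : EuclideanSpace ℝ (Fin N)) (d : ℝ), 0 < d →
      ∫⁻ x, ENNReal.ofReal (kernel s p (x, y)) *
        ENNReal.ofReal ((min 1 (2 * ‖x - y‖ / d)) ^ p) ≤ C * ENNReal.ofReal (d ^ (-(s * p))) := by
  set f : ℝ → ℝ := fun r => (min 1 (2 * r)) ^ p * (r ^ ((N : ℝ) + s * p))⁻¹ with hf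
  have hfin : Module.finrank ℝ (EuclideanSpace ℝ (Fin N)) = N := by simp
  have : Nontrivial (EuclideanSpace ℝ (Fin N)) :=
    Module.nontrivial_of_finrank_pos (R := ℝ) (by rw [hfin]; exact hN)
  have hint : Integrable (fun z : EuclideanSpace ℝ (Fin N) => f ‖z‖) := by
    rw [integrable_fun_norm_addHaar, hfin]
    exact integrableOn_radial_profile hN hs0 hs1 hp
  have hfm : Measurable fun z : EuclideanSpace ℝ (Fin N) => ENNReal.ofReal (f ‖z‖) := by
    simp only [hf]; fun_prop
  refine ⟨∫⁻ z : EuclideanSpace ℝ (Fin N), ENNReal.ofReal (f ‖z‖), ?_, fun y d hd => ?_⟩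
  · have := hint.lintegral_lt_top
    exact this.ne
  -- The substitution `x = y + d z` produces `d^N` from the volume and `d^{-(N+sp)}` from the
  -- kernel, hence the factor `d^{-sp}`.
  have hscale : ∫⁻ x : EuclideanSpace ℝ (Fin N), ENNReal.ofReal (f ‖d⁻¹ • x‖) =
      ENNReal.ofReal (d ^ N) * ∫⁻ z : EuclideanSpace ℝ (Fin N), ENNReal.ofReal (f ‖z‖) := by
    have h := lintegral_map (μ := (volume : Measure (EuclideanSpace ℝ (Fin N)))) hfm
      (measurable_const_smul d⁻¹)
    rw [← h, Measure.map_addHaar_smul _ (inv_ne_zero hd.ne'), lintegral_smul_measure, hfin,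
      smul_eq_mul]
    congr 2
    rw [inv_pow, inv_inv, abs_of_pos (by positivity)]
  have htrans : ∫⁻ x, ENNReal.ofReal (kernel s p (x, y)) *
        ENNReal.ofReal ((min 1 (2 * ‖x - y‖ / d)) ^ p) =
      ∫⁻ x : EuclideanSpace ℝ (Fin N), ENNReal.ofReal (d ^ (-((N : ℝ) + s * p))) *
        ENNReal.ofReal (f ‖d⁻¹ • x‖) := by
    rw [← lintegral_sub_right_eq_self (fun x : EuclideanSpace ℝ (Fin N) =>
      ENNReal.ofReal (d ^ (-((N : ℝ) + s * p))) * ENNReal.ofReal (f ‖d⁻¹ • x‖)) y]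
    refine lintegral_congr fun x => ?_
    rw [← ENNReal.ofReal_mul (kernel_nonneg s p _), ← ENNReal.ofReal_mul (by positivity)]
    congr 1
    simp only [hf, kernel, norm_smul, norm_inv, Real.norm_of_nonneg hd.le]
    rw [Real.mul_rpow (by positivity) (norm_nonneg _), Real.inv_rpow hd.le, mul_inv, inv_inv,
      Real.rpow_neg hd.le]
    have : 2 * (d⁻¹ * ‖x - y‖) = 2 * ‖x - y‖ / d := by field_simp
    rw [this]
    have hne : d ^ ((N : ℝ) + s * p) ≠ 0 := by positivity
    field_simp
  rw [htrans, lintegral_const_mul _ (by simp only [hf]; fun_prop), hscale, ← mul_assoc,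
    ← ENNReal.ofReal_mul (by positivity), mul_comm]
  refine le_of_eq ?_
  congr 2
  rw [← Real.rpow_natCast, ← Real.rpow_add hd]
  congr 1; ring

/-- Every point `x` of `Ω` sees a ball of the complement, of radius and at distance comparable to
the distance from `x` to the complement. -/
def ExteriorBallCondition (κ : ℝ) (Ω : Set (EuclideanSpace ℝ (Fin N))) : Prop :=
  ∀ x ∈ Ω, ∃ w, Metric.ball w (κ * Metric.infDist x Ωᶜ) ⊆ Ωᶜ ∧
    ∀ y ∈ Metric.ball w (κ * Metric.infDist x Ωᶜ), dist x y ≤ 3 * Metric.infDist x Ωᶜ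

/-- With `d` the distance from `x` to `Ωᶜ`, it suffices to integrate over the exterior ball: its
volume is of order `(κ d)^N`, and the kernel is at least `(3d)^{-(N+sp)}` on it. -/
lemma le_lintegral_compl_kernel {s p : ℝ} (hs0 : 0 < s) (hp : 1 < p)
    {Ω : Set (EuclideanSpace ℝ (Fin N))} (hΩ : IsOpen Ω) (hΩc : Ωᶜ.Nonempty) {κ : ℝ} (hκ : 0 < κ)
    (hext : ExteriorBallCondition κ Ω) : ∃ c : ℝ≥0∞, c ≠ 0 ∧ c ≠ ⊤ ∧ ∀ x ∈ Ω,
      c * ENNReal.ofReal (Metric.infDist x Ωᶜ ^ (-(s * p))) ≤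
        ∫⁻ y in Ωᶜ, ENNReal.ofReal (kernel s p (x, y)) := by
  have hsp : 0 < s * p := by positivity
  refine ⟨ENNReal.ofReal (κ ^ N * 3 ^ (-((N : ℝ) + s * p))) *
    volume (Metric.ball (0 : EuclideanSpace ℝ (Fin N)) 1), ?_, ?_, fun x hx => ?_⟩
  · refine mul_ne_zero ?_ ?_
    · rw [Ne, ENNReal.ofReal_eq_zero, not_le]; positivity
    · exact (Metric.measure_ball_pos volume _ one_pos).ne'
  · exact ENNReal.mul_ne_top ENNReal.ofReal_ne_top measure_ball_lt_top.ne
  obtain ⟨w, hw, hdist⟩ := hext x hx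
  have hd : 0 < Metric.infDist x Ωᶜ :=
    (hΩ.isClosed_compl.notMem_iff_infDist_pos hΩc).1 (by simpa using hx)
  set d := Metric.infDist x Ωᶜ
  calc _ = ENNReal.ofReal ((3 * d) ^ (-((N : ℝ) + s * p))) *
        volume (Metric.ball w (κ * d)) := by
        rw [Measure.addHaar_ball_of_pos _ w (by positivity : 0 < κ * d), ← mul_assoc,
          ← ENNReal.ofReal_mul (by positivity), mul_right_comm, ← ENNReal.ofReal_mul (by positivity)]
        congr 2
        rw [finrank_euclideanSpace_fin, mul_pow, Real.mul_rpow (by norm_num) hd.le,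
          ← Real.rpow_natCast d]
        have : d ^ (-(s * p)) = d ^ (-((N : ℝ) + s * p)) * d ^ (N : ℝ) := by
          rw [← Real.rpow_add hd]; congr 1; ring
        rw [this]; ring
    _ = ∫⁻ _y in Metric.ball w (κ * d), ENNReal.ofReal ((3 * d) ^ (-((N : ℝ) + s * p))) := by
        rw [setLIntegral_const]
    _ ≤ ∫⁻ y in Metric.ball w (κ * d), ENNReal.ofReal (kernel s p (x, y)) := by
        refine setLIntegral_mono' measurableSet_ball fun y hy => ENNReal.ofReal_le_ofReal ?_
        have hxy : 0 < ‖x - y‖ := by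
          rw [norm_pos_iff, sub_ne_zero]
          rintro rfl
          exact hw hy hx
        rw [kernel, ← Real.rpow_neg (norm_nonneg _)]
        refine Real.rpow_le_rpow_of_nonpos hxy ?_ ?_
        · rw [← dist_eq_norm]; exact hdist y hy
        · have : (0 : ℝ) ≤ N := N.cast_nonneg
          linarith
    _ ≤ _ := lintegral_mono_set hw

/-- Fractional Hardy inequality for functions on the whole space vanishing outside `Ω`. -/
lemma lintegral_hardy {s p : ℝ} (hs0 : 0 < s) (hp : 1 < p)
    {Ω : Set (EuclideanSpace ℝ (Fin N))} (hΩ : IsOpen Ω) (hΩc : Ωᶜ.Nonempty) {κ : ℝ} (hκ : 0 < κ)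
    (hext : ExteriorBallCondition κ Ω) {u : EuclideanSpace ℝ (Fin N) → ℝ} (hu : Measurable u)
    (hu0 : ∀ x ∉ Ω, u x = 0) (hug : gagliardo s p univ u < ⊤) :
    ∫⁻ x in Ω, ‖u x‖ₑ ^ p * ENNReal.ofReal (Metric.infDist x Ωᶜ ^ (-(s * p))) < ⊤ := by
  obtain ⟨c, hc0, hct, hc⟩ := le_lintegral_compl_kernel hs0 hp hΩ hΩc hκ hext
  have hmk : Measurable fun q : EuclideanSpace ℝ (Fin N) × EuclideanSpace ℝ (Fin N) =>
      ENNReal.ofReal (kernel s p q) := (measurable_kernel s p).ennreal_ofReal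
  have hmd : Measurable fun x : EuclideanSpace ℝ (Fin N) =>
      ENNReal.ofReal (Metric.infDist x Ωᶜ ^ (-(s * p))) := by
    have := Metric.continuous_infDist_pt Ωᶜ
    exact (this.measurable.pow_const _).ennreal_ofReal
  have hmud : Measurable fun x : EuclideanSpace ℝ (Fin N) =>
      ‖u x‖ₑ ^ p * ENNReal.ofReal (Metric.infDist x Ωᶜ ^ (-(s * p))) :=
    (hu.enorm.pow_const p).mul hmd
  -- Only the part of the double integral over `Ω × Ωᶜ` is kept: there `u(y) = 0`, and integrating
  -- the kernel in `y` produces the weight `d(x)^{-sp}`.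
  have key : c * ∫⁻ x in Ω, ‖u x‖ₑ ^ p * ENNReal.ofReal (Metric.infDist x Ωᶜ ^ (-(s * p))) ≤
      gagliardo s p univ u := by
    rw [gagliardo_eq (by linarith) MeasurableSet.univ hu, univ_prod_univ, Measure.restrict_univ,
      lintegral_kernelMeasure _ _ ((measurable_increment hu).enorm.pow_const p),
      Measure.volume_eq_prod, lintegral_prod _ (by
        exact (hmk.mul ((measurable_increment hu).enorm.pow_const p)).aemeasurable),
      ← lintegral_const_mul _ hmud]
    refine (setLIntegral_mono' hΩ.measurableSet fun x hx => ?_).trans (setLIntegral_le_lintegral Ω _)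
    calc c * (‖u x‖ₑ ^ p * ENNReal.ofReal (Metric.infDist x Ωᶜ ^ (-(s * p))))
        = ‖u x‖ₑ ^ p * (c * ENNReal.ofReal (Metric.infDist x Ωᶜ ^ (-(s * p)))) := by ring
      _ ≤ ‖u x‖ₑ ^ p * ∫⁻ y in Ωᶜ, ENNReal.ofReal (kernel s p (x, y)) := by
          gcongr; exact hc x hx
      _ = ∫⁻ y in Ωᶜ, ENNReal.ofReal (kernel s p (x, y)) * ‖increment u (x, y)‖ₑ ^ p := by
          have hmx : Measurable fun y => ENNReal.ofReal (kernel s p (x, y)) :=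
            hmk.comp measurable_prodMk_left
          rw [← lintegral_const_mul _ hmx]
          refine setLIntegral_congr_fun hΩ.measurableSet.compl fun y hy => ?_
          simp only [increment, hu0 y hy, sub_zero]
          rw [mul_comm]
      _ ≤ _ := setLIntegral_le_lintegral _ _
  refine lt_of_le_of_ne le_top fun h => ?_
  rw [h, ENNReal.mul_top hc0, top_le_iff] at key
  exact hug.ne key

/-! ### Exterior cones and exterior balls of a smooth domain. -/

/-- Near a regular boundary point, boundary points are vertices of exterior cones of uniform size. -/
lemma exists_local_exterior_cone {Ω : Set (EuclideanSpace ℝ (Fin N))}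
    (hΩ : IsSmoothBoundedDomain Ω) {x₀ : EuclideanSpace ℝ (Fin N)} (hx₀ : x₀ ∈ frontier Ω) :
    ∃ r > 0, ∃ κ > 0, ∃ t₀ > 0, ∀ z ∈ Metric.ball x₀ r, z ∈ frontier Ω → ∀ t, 0 < t → t ≤ t₀ →
      ∃ w, Metric.ball w (κ * t) ⊆ Ωᶜ ∩ Metric.ball z (2 * t) := by
  obtain ⟨U, ρ, hU, hxU, hρ, hρ0, hΩU⟩ := hΩ.smooth_boundary x₀ hx₀
  set L := fderiv ℝ ρ x₀ with hL
  obtain ⟨e, he1, hea⟩ : ∃ e, ‖e‖ = 1 ∧ 0 < L e := by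
    obtain ⟨v, hv⟩ : ∃ v, L v ≠ 0 := by
      by_contra! h
      exact hρ0 (ContinuousLinearMap.ext h)
    obtain ⟨v, hv⟩ : ∃ v, 0 < L v := by
      rcases lt_or_gt_of_ne hv with h | h
      · exact ⟨-v, by simpa using h⟩
      · exact ⟨v, h⟩
    have hv0 : v ≠ 0 := by rintro rfl; simp at hv
    refine ⟨‖v‖⁻¹ • v, ?_, ?_⟩
    · rw [norm_smul, norm_inv, norm_norm, inv_mul_cancel₀ (norm_ne_zero_iff.2 hv0)]
    · rw [map_smul, smul_eq_mul]
      have := norm_pos_iff.2 hv0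
      positivity
  -- Strict differentiability compares `ρ` at any two points near `x₀`, so one direction `e` and one
  -- aperture serve all nearby boundary points.
  have hstrict : HasStrictFDerivAt ρ L x₀ :=
    hρ.contDiffAt.hasStrictFDerivAt (by simp)
  have hε : 0 < L e / 8 := by positivity
  have hev := hstrict.isLittleO.def hε
  obtain ⟨R, hR, hball⟩ : ∃ R > 0, ∀ y ∈ Metric.ball x₀ R, ∀ z ∈ Metric.ball x₀ R, y ∈ U ∧
      ‖ρ y - ρ z - L (y - z)‖ ≤ L e / 8 * ‖y - z‖ := by
    obtain ⟨R₁, hR₁, h₁⟩ := Metric.eventually_nhds_iff_ball.1 hev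
    obtain ⟨R₂, hR₂, h₂⟩ := Metric.isOpen_iff.1 hU x₀ hxU
    refine ⟨min R₁ R₂, lt_min hR₁ hR₂, fun y hy z hz => ⟨h₂ ?_, ?_⟩⟩
    · exact Metric.ball_subset_ball (min_le_right _ _) hy
    · refine h₁ (y, z) ?_
      rw [← ball_prod_same]
      exact ⟨Metric.ball_subset_ball (min_le_left _ _) hy,
        Metric.ball_subset_ball (min_le_left _ _) hz⟩
  -- On the ball of radius `κ t` about `z + t e`, the linear part of `ρ y - ρ z` is at least `t L e
  -- / 2`. The remainder is at most `(L e / 8) · 2t = t L e / 4`, so `ρ y > 0` there.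
  set κ := min 1 (L e / (2 * (‖L‖ + 1)))
  have hκ0 : 0 < κ := lt_min one_pos (by positivity)
  have hκ1 : κ ≤ 1 := min_le_left _ _
  have hκL : ‖L‖ * κ ≤ L e / 2 := by
    calc ‖L‖ * κ ≤ (‖L‖ + 1) * (L e / (2 * (‖L‖ + 1))) :=
          mul_le_mul (by linarith) (min_le_right _ _) hκ0.le (by positivity)
      _ = L e / 2 := by field_simp
  refine ⟨R / 2, by positivity, κ, hκ0, R / 4, by positivity, fun z hz hzf t ht ht₀ =>
    ⟨z + t • e, fun y hy => ?_⟩⟩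
  have hh : ‖y - (z + t • e)‖ < κ * t := by rwa [← dist_eq_norm]
  have hte : ‖t • e‖ = t := by rw [norm_smul, he1, mul_one, Real.norm_of_nonneg ht.le]
  have hyz : ‖y - z‖ < 2 * t := by
    calc ‖y - z‖ = ‖(y - (z + t • e)) + t • e‖ := by congr 1; abel
      _ ≤ ‖y - (z + t • e)‖ + ‖t • e‖ := norm_add_le _ _
      _ < κ * t + t := by rw [hte]; linarith
      _ ≤ 2 * t := by nlinarith
  have hzR : z ∈ Metric.ball x₀ R := Metric.ball_subset_ball (by linarith) hz
  have hyR : y ∈ Metric.ball x₀ R := by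
    rw [Metric.mem_ball] at hz ⊢
    calc dist y x₀ ≤ dist y z + dist z x₀ := dist_triangle _ _ _
      _ < R := by rw [dist_eq_norm y z]; linarith
  refine ⟨fun hyΩ => ?_, by rwa [Metric.mem_ball, dist_eq_norm]⟩
  obtain ⟨hyU, hle⟩ := hball y hyR z hzR
  have hzU := (hball z hzR z hzR).1
  have hzΩ : z ∉ Ω := by
    rw [hΩ.isOpen.frontier_eq] at hzf
    exact hzf.2
  have hρz : 0 ≤ ρ z := by
    by_contra! h
    have : z ∈ Ω ∩ U := by rw [hΩU]; exact ⟨hzU, h⟩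
    exact hzΩ this.1
  have hρy : ρ y < 0 := by
    have : y ∈ Ω ∩ U := ⟨hyΩ, hyU⟩
    rw [hΩU] at this
    exact this.2
  have hLyz : t * L e / 2 ≤ L (y - z) := by
    have h1 : L (y - z) = L (y - (z + t • e)) + t * L e := by
      rw [← smul_eq_mul, ← map_smul, ← map_add]; congr 1; abel
    have h2 : |L (y - (z + t • e))| ≤ ‖L‖ * (κ * t) :=
      (L.le_opNorm _).trans (by gcongr)
    have h3 := neg_abs_le (L (y - (z + t • e)))
    nlinarith
  have h4 := neg_abs_le (ρ y - ρ z - L (y - z))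
  rw [Real.norm_eq_abs] at hle
  nlinarith

/-- The boundary is compact, and the property passes to finite unions by taking the smaller
constants. -/
lemma exists_exterior_cone {Ω : Set (EuclideanSpace ℝ (Fin N))} (hΩ : IsSmoothBoundedDomain Ω) :
    ∃ κ > 0, ∃ t₀ > 0, ∀ z ∈ frontier Ω, ∀ t, 0 < t → t ≤ t₀ →
      ∃ w, Metric.ball w (κ * t) ⊆ Ωᶜ ∩ Metric.ball z (2 * t) := by
  have hcomp : IsCompact (frontier Ω) :=
    hΩ.isBounded.isCompact_closure.of_isClosed_subset isClosed_frontier frontier_subset_closure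
  refine hcomp.induction_on (p := fun S => ∃ κ > 0, ∃ t₀ > 0, ∀ z ∈ S, ∀ t, 0 < t → t ≤ t₀ →
      ∃ w, Metric.ball w (κ * t) ⊆ Ωᶜ ∩ Metric.ball z (2 * t)) ?_ ?_ ?_ ?_
  · exact ⟨1, one_pos, 1, one_pos, by simp⟩
  · rintro S T hST ⟨κ, hκ, t₀, ht₀, h⟩
    exact ⟨κ, hκ, t₀, ht₀, fun z hz => h z (hST hz)⟩
  · rintro S T ⟨κ, hκ, t₀, ht₀, h⟩ ⟨κ', hκ', t₀', ht₀', h'⟩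
    refine ⟨min κ κ', lt_min hκ hκ', min t₀ t₀', lt_min ht₀ ht₀', ?_⟩
    rintro z (hz | hz) t ht htt
    · obtain ⟨w, hw⟩ := h z hz t ht (htt.trans (min_le_left _ _))
      exact ⟨w, (Metric.ball_subset_ball (by gcongr; exact min_le_left _ _)).trans hw⟩
    · obtain ⟨w, hw⟩ := h' z hz t ht (htt.trans (min_le_right _ _))
      exact ⟨w, (Metric.ball_subset_ball (by gcongr; exact min_le_right _ _)).trans hw⟩
  · intro x hx
    obtain ⟨r, hr, κ, hκ, t₀, ht₀, h⟩ := exists_local_exterior_cone hΩ hx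
    exact ⟨Metric.ball x r ∩ frontier Ω, inter_comm (frontier Ω) _ ▸
      inter_mem_nhdsWithin _ (Metric.ball_mem_nhds x hr), κ, hκ, t₀, ht₀, fun z hz => h z hz.1 hz.2⟩

lemma IsSmoothBoundedDomain.compl_nonempty {Ω : Set (EuclideanSpace ℝ (Fin N))} (hN : 0 < N)
    (hΩ : IsSmoothBoundedDomain Ω) : Ωᶜ.Nonempty := by
  have hfin : Module.finrank ℝ (EuclideanSpace ℝ (Fin N)) = N := by simp
  have : Nontrivial (EuclideanSpace ℝ (Fin N)) :=
    Module.nontrivial_of_finrank_pos (R := ℝ) (by rw [hfin]; exact hN)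
  rw [nonempty_compl]
  rintro rfl
  exact NoncompactSpace.noncompact_univ
    (Metric.isCompact_of_isClosed_isBounded isClosed_univ hΩ.isBounded)

/-- The point of `Ωᶜ` nearest to `x` lies on the boundary, and the exterior cone at that point
contains a ball of the required size. -/
lemma IsSmoothBoundedDomain.exists_exteriorBallCondition {Ω : Set (EuclideanSpace ℝ (Fin N))}
    (hN : 0 < N) (hΩ : IsSmoothBoundedDomain Ω) : ∃ κ > 0, ExteriorBallCondition κ Ω := by
  obtain ⟨κ, hκ, t₀, ht₀, hcone⟩ := exists_exterior_cone hΩ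
  obtain ⟨z₀, hz₀⟩ := hΩ.compl_nonempty hN
  obtain ⟨D, hD⟩ := hΩ.isBounded.subset_closedBall z₀
  have hD0 : 0 ≤ D := by
    obtain ⟨x, hx⟩ := hΩ.isConnected.nonempty
    exact dist_nonneg.trans (Metric.mem_closedBall.1 (hD hx))
  -- Distances to the complement are at most `D`, so the second bound gives `τ d ≤ t₀`; `τ ≤ 1`
  -- keeps the ball within `d + 2d = 3d` of `x`.
  set τ := min 1 (t₀ / (D + 1))
  have hτ : 0 < τ := lt_min one_pos (by positivity)
  refine ⟨κ * τ, by positivity, fun x hx => ?_⟩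
  have hd : 0 < Metric.infDist x Ωᶜ :=
    (hΩ.isOpen.isClosed_compl.notMem_iff_infDist_pos ⟨z₀, hz₀⟩).1 (by simpa using hx)
  have hdD : Metric.infDist x Ωᶜ ≤ D :=
    (Metric.infDist_le_dist_of_mem hz₀).trans (Metric.mem_closedBall.1 (hD hx))
  obtain ⟨z, hzΩ, hzd⟩ := hΩ.isOpen.isClosed_compl.exists_infDist_eq_dist ⟨z₀, hz₀⟩ x
  set d := Metric.infDist x Ωᶜ
  have hzf : z ∈ frontier Ω := by
    rw [hΩ.isOpen.frontier_eq]
    refine ⟨?_, hzΩ⟩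
    have hsub : Metric.ball x d ⊆ Ω := by
      have := Metric.ball_infDist_compl_subset (s := Ω) (x := x)
      exact this
    refine closure_mono hsub ?_
    rw [closure_ball x hd.ne', Metric.mem_closedBall, dist_comm, hzd]
  have ht : τ * d ≤ t₀ := by
    calc τ * d ≤ t₀ / (D + 1) * (D + 1) :=
          mul_le_mul (min_le_right _ _) (by linarith) hd.le (by positivity)
      _ = t₀ := by field_simp
  obtain ⟨w, hw⟩ := hcone z hzf (τ * d) (by positivity) ht
  refine ⟨w, by rw [mul_assoc]; exact hw.trans inter_subset_left, fun y hy => ?_⟩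
  rw [mul_assoc] at hy
  have hyz : dist y z < 2 * (τ * d) := (hw hy).2
  have hτd : τ * d ≤ d := mul_le_of_le_one_left hd.le (min_le_left _ _)
  calc dist x y ≤ dist x z + dist z y := dist_triangle _ _ _
    _ ≤ 3 * d := by rw [dist_comm z y, ← hzd]; linarith

/-! ### Mollification in the Gagliardo seminorm. -/

/-- Continuity of translations in `L^p`. -/
lemma tendsto_lintegral_sub_translate {H : Type*} [NormedAddCommGroup H] [NormedSpace ℝ H]
    [FiniteDimensional ℝ H] [MeasurableSpace H] [BorelSpace H] (μ : Measure H)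
    [μ.IsAddHaarMeasure] {p : ℝ} (hp : 1 ≤ p) {F : H → ℝ} (hF : MemLp F (ENNReal.ofReal p) μ) :
    Tendsto (fun h : H => ∫⁻ q, ‖F (q - h) - F q‖ₑ ^ p ∂μ) (𝓝 0) (𝓝 0) := by
  have hp0 : 0 < p := by linarith
  have : Fact (1 ≤ ENNReal.ofReal p) := ⟨by simpa using hp⟩
  have : Fact (ENNReal.ofReal p ≠ ⊤) := ⟨ENNReal.ofReal_ne_top⟩
  have : ProperSpace H := FiniteDimensional.proper ℝ H
  have hcont : Continuous fun h : H => DomAddAct.mk (-h) +ᵥ hF.toLp F :=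
    Continuous.vadd (DomAddAct.continuous_mk.comp continuous_neg) continuous_const
  have h0 : Tendsto (fun h : H => edist (DomAddAct.mk (-h) +ᵥ hF.toLp F) (hF.toLp F))
      (𝓝 0) (𝓝 0) := by
    have h1 := (hcont.tendsto 0).edist (tendsto_const_nhds (x := hF.toLp F))
    have h2 : DomAddAct.mk (-(0 : H)) +ᵥ hF.toLp F = hF.toLp F := by
      rw [neg_zero]
      exact zero_vadd _ _
    rwa [h2, edist_self] at h1
  have h3 : ∀ h : H, ∫⁻ q, ‖F (q - h) - F q‖ₑ ^ p ∂μ =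
      edist (DomAddAct.mk (-h) +ᵥ hF.toLp F) (hF.toLp F) ^ p := by
    intro h
    rw [DomAddAct.mk_vadd_toLp, Lp.edist_toLp_toLp, eLpNorm_eq_lintegral_rpow_enorm_toReal
      (ENNReal.ofReal_pos.2 hp0).ne' ENNReal.ofReal_ne_top, ENNReal.toReal_ofReal hp0.le,
      ← ENNReal.rpow_mul, one_div, inv_mul_cancel₀ hp0.ne', ENNReal.rpow_one]
    refine lintegral_congr fun q => ?_
    have : q - h = -h +ᵥ q := by rw [vadd_eq_add, sub_eq_add_neg, add_comm]
    rw [this]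
    rfl
  simp_rw [h3]
  have := (ENNReal.continuous_rpow_const (y := p)).tendsto 0 |>.comp h0
  rwa [ENNReal.zero_rpow_of_pos hp0] at this

/-- Jensen's inequality, deduced from the monotonicity of `L^q` norms on a probability space. -/
lemma enorm_integral_rpow_le {α : Type*} [MeasurableSpace α] {P : Measure α}
    [IsProbabilityMeasure P] {p : ℝ} (hp : 1 ≤ p) {g : α → ℝ} (hg : AEStronglyMeasurable g P) :
    ‖∫ h, g h ∂P‖ₑ ^ p ≤ ∫⁻ h, ‖g h‖ₑ ^ p ∂P := by
  have hp0 : 0 < p := by linarith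
  have h1 : ‖∫ h, g h ∂P‖ₑ ≤ eLpNorm g (ENNReal.ofReal p) P := by
    calc ‖∫ h, g h ∂P‖ₑ ≤ ∫⁻ h, ‖g h‖ₑ ∂P := enorm_integral_le_lintegral_enorm _
      _ = eLpNorm g 1 P := eLpNorm_one_eq_lintegral_enorm.symm
      _ ≤ _ := eLpNorm_le_eLpNorm_of_exponent_le (by simpa using hp) hg
  rw [eLpNorm_eq_lintegral_rpow_enorm_toReal
      (ENNReal.ofReal_pos.2 hp0).ne' ENNReal.ofReal_ne_top, ENNReal.toReal_ofReal hp0.le] at h1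
  calc _ ≤ ((∫⁻ h, ‖g h‖ₑ ^ p ∂P) ^ (1 / p)) ^ p := ENNReal.rpow_le_rpow h1 hp0.le
    _ = _ := by rw [← ENNReal.rpow_mul, one_div, inv_mul_cancel₀ hp0.ne', ENNReal.rpow_one]

/-- Averaging over small translations changes a function little in the Gagliardo seminorm. -/
lemma gagliardo_average_sub_le {s p : ℝ} (hp : 1 < p) {ψ φ : EuclideanSpace ℝ (Fin N) → ℝ}
    (hψ : Measurable ψ) (hφ : Measurable φ) {M : ℝ} (hM : ∀ x, |ψ x| ≤ M)
    (P : Measure (EuclideanSpace ℝ (Fin N))) [IsProbabilityMeasure P]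
    (hφψ : ∀ x, φ x = ∫ h, ψ (x - h) ∂P) :
    gagliardo s p univ (fun x => φ x - ψ x) ≤
      ∫⁻ h, (∫⁻ q : EuclideanSpace ℝ (Fin N) × EuclideanSpace ℝ (Fin N),
        ‖kernel s p (q - (h, h)) ^ (1 / p) * increment ψ (q - (h, h)) -
          kernel s p q ^ (1 / p) * increment ψ q‖ₑ ^ p) ∂P := by
  have hp0 : 0 < p := by linarith
  have hint : ∀ x, Integrable (fun h => ψ (x - h)) P := fun x =>
    Integrable.of_bound (hψ.comp (measurable_const.sub measurable_id)).aestronglyMeasurable M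
      (Eventually.of_forall fun h => hM _)
  have hinc : ∀ q : EuclideanSpace ℝ (Fin N) × EuclideanSpace ℝ (Fin N),
      increment (fun x => φ x - ψ x) q = ∫ h, (increment ψ (q - (h, h)) - increment ψ q) ∂P := by
    intro q
    simp only [increment, Prod.fst_sub, Prod.snd_sub]
    have h1 : Integrable (fun h => ψ (q.1 - h) - ψ (q.2 - h)) P := (hint _).sub (hint _)
    rw [integral_sub h1 (integrable_const _), integral_sub (hint _) (hint _),
      ← hφψ, ← hφψ, integral_const, probReal_univ, one_smul]
    ring
  -- Diagonal translations leave the kernel invariant, so the weight `kernel^{1/p}` may be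
  -- translated along with the increment. The seminorm thus becomes an unweighted `L^p` norm on
  -- `ℝ^{2N}`.
  have hker : ∀ (q : EuclideanSpace ℝ (Fin N) × EuclideanSpace ℝ (Fin N))
      (h : EuclideanSpace ℝ (Fin N)), kernel s p (q - (h, h)) = kernel s p q := by
    intro q h
    simp only [kernel, Prod.fst_sub, Prod.snd_sub, sub_sub_sub_cancel_right]
  have hmF : Measurable fun q : EuclideanSpace ℝ (Fin N) × EuclideanSpace ℝ (Fin N) =>
      kernel s p q ^ (1 / p) * increment ψ q :=
    ((measurable_kernel s p).pow_const _).mul (measurable_increment hψ)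
  have hφψm : Measurable fun x => φ x - ψ x := hφ.sub hψ
  rw [gagliardo_eq hp0 MeasurableSet.univ hφψm, univ_prod_univ, Measure.restrict_univ,
    lintegral_kernelMeasure _ _ ((measurable_increment hφψm).enorm.pow_const p),
    lintegral_lintegral_swap]
  · refine lintegral_mono fun q => ?_
    have hk : ENNReal.ofReal (kernel s p q) = ENNReal.ofReal (kernel s p q ^ (1 / p)) ^ p := by
      rw [ENNReal.ofReal_rpow_of_nonneg (Real.rpow_nonneg (kernel_nonneg s p q) _) hp0.le,
        ← Real.rpow_mul (kernel_nonneg s p q), one_div, inv_mul_cancel₀ hp0.ne', Real.rpow_one]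
    have hm : Measurable fun h : EuclideanSpace ℝ (Fin N) =>
        increment ψ (q - (h, h)) - increment ψ q :=
      ((measurable_increment hψ).comp (by fun_prop)).sub_const _
    calc ENNReal.ofReal (kernel s p q) * ‖increment (fun x => φ x - ψ x) q‖ₑ ^ p
        ≤ ENNReal.ofReal (kernel s p q) *
            ∫⁻ h, ‖increment ψ (q - (h, h)) - increment ψ q‖ₑ ^ p ∂P := by
          rw [hinc]
          gcongr
          exact enorm_integral_rpow_le hp.le hm.aestronglyMeasurable
      _ = ∫⁻ h, ‖kernel s p (q - (h, h)) ^ (1 / p) * increment ψ (q - (h, h)) -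
          kernel s p q ^ (1 / p) * increment ψ q‖ₑ ^ p ∂P := by
          rw [← lintegral_const_mul _ (hm.enorm.pow_const p)]
          refine lintegral_congr fun h => ?_
          rw [hker, ← mul_sub, enorm_mul, ENNReal.mul_rpow_of_nonneg _ _ hp0.le, hk,
            Real.enorm_of_nonneg (Real.rpow_nonneg (kernel_nonneg s p q) _)]
  · refine Measurable.aemeasurable ?_
    refine (Measurable.enorm (Measurable.sub ?_ ?_)).pow_const p
    · exact hmF.comp (f := fun z : EuclideanSpace ℝ (Fin N) ×
        (EuclideanSpace ℝ (Fin N) × EuclideanSpace ℝ (Fin N)) => z.2 - (z.1, z.1)) (by fun_prop)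
    · exact hmF.comp measurable_snd

/-- Bounded functions of finite Gagliardo seminorm and compact support in `Ω` are limits of test
functions. -/
lemma exists_nonnegTest_seq {s p : ℝ} (hp : 1 < p)
    {Ω K : Set (EuclideanSpace ℝ (Fin N))} (hΩ : IsOpen Ω) (hK : IsCompact K) (hKΩ : K ⊆ Ω)
    {ψ : EuclideanSpace ℝ (Fin N) → ℝ} (hψ : Measurable ψ) (hψ0 : ∀ x, 0 ≤ ψ x) {M : ℝ}
    (hM : ∀ x, ψ x ≤ M) (hψK : ∀ x ∉ K, ψ x = 0) (hψg : gagliardo s p univ ψ < ⊤) :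
    ∃ (K₁ : Set (EuclideanSpace ℝ (Fin N))) (φ : ℕ → EuclideanSpace ℝ (Fin N) → ℝ),
      IsCompact K₁ ∧ K ⊆ K₁ ∧ K₁ ⊆ Ω ∧ (∀ k, IsNonnegTest Ω (φ k)) ∧ (∀ k x, φ k x ≤ M) ∧
      (∀ k, ∀ x ∉ K₁, φ k x = 0) ∧ (∀ᵐ x, Tendsto (fun k => φ k x) atTop (𝓝 (ψ x))) ∧
      Tendsto (fun k => gagliardo s p univ (fun x => φ k x - ψ x)) atTop (𝓝 0) := by
  have hp0 : 0 < p := by linarith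
  obtain ⟨δ, hδ, hδΩ⟩ := hK.exists_cthickening_subset_open hΩ hKΩ
  have hK₁ : IsCompact (Metric.cthickening δ K) := hK.cthickening
  -- Outer radii at most `δ` keep all mollifications supported in the `δ`-thickening of `K`; the
  -- fixed ratio `2` of the radii is what a.e. convergence asks for.
  let B : ℕ → ContDiffBump (0 : EuclideanSpace ℝ (Fin N)) := fun k =>
    ⟨δ / (2 * (k + 1)), δ / (k + 1), by positivity, by
      rw [div_lt_div_iff_of_pos_left hδ (by positivity) (by positivity)]
      have : (0 : ℝ) < k + 1 := by positivity
      linarith⟩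
  have hBout : ∀ k, (B k).rOut = δ / (k + 1) := fun k => rfl
  have hBle : ∀ k, (B k).rOut ≤ δ := fun k =>
    (hBout k).trans_le (div_le_self hδ.le (by linarith [(k.cast_nonneg : (0 : ℝ) ≤ k)]))
  have hBlim : Tendsto (fun k => (B k).rOut) atTop (𝓝 0) := by
    simp_rw [hBout]
    have := tendsto_one_div_add_atTop_nhds_zero_nat.const_mul δ
    simpa [div_eq_mul_inv] using this
  have habs : ∀ x, |ψ x| ≤ M := fun x => by rw [abs_of_nonneg (hψ0 x)]; exact hM x
  have hloc : LocallyIntegrable ψ volume := by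
    refine (locallyIntegrable_const M).mono hψ.aestronglyMeasurable
      (Eventually.of_forall fun x => ?_)
    exact (habs x).trans (le_abs_self M)
  let P : ℕ → Measure (EuclideanSpace ℝ (Fin N)) := fun k =>
    volume.withDensity fun h => ENNReal.ofReal ((B k).normed volume h)
  have hmB : ∀ k, Measurable fun h => ENNReal.ofReal ((B k).normed volume h) := fun k =>
    (B k).continuous_normed.measurable.ennreal_ofReal
  have hP : ∀ k, IsProbabilityMeasure (P k) := by
    intro k
    refine ⟨?_⟩
    rw [withDensity_apply _ MeasurableSet.univ, Measure.restrict_univ,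
      ← ofReal_integral_eq_lintegral_ofReal (B k).integrable_normed
        (Eventually.of_forall (B k).nonneg_normed), (B k).integral_normed, ENNReal.ofReal_one]
  let φ : ℕ → EuclideanSpace ℝ (Fin N) → ℝ := fun k =>
    MeasureTheory.convolution ((B k).normed volume) ψ (ContinuousLinearMap.lsmul ℝ ℝ) volume
  have hφP : ∀ k x, φ k x = ∫ h, ψ (x - h) ∂P k := by
    intro k x
    rw [integral_withDensity_eq_integral_toReal_smul (hmB k)
      (Eventually.of_forall fun _ => ENNReal.ofReal_lt_top)]
    simp only [φ, convolution_def, ContinuousLinearMap.lsmul_apply]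
    refine integral_congr_ae (Eventually.of_forall fun h => ?_)
    simp only [ENNReal.toReal_ofReal ((B k).nonneg_normed h)]
  have hPball : ∀ k, ∀ᵐ h ∂P k, ‖h‖ < (B k).rOut := by
    intro k
    rw [ae_withDensity_iff (hmB k)]
    refine Eventually.of_forall fun h hh => ?_
    have : h ∈ Function.support ((B k).normed volume) := by
      intro h0
      exact hh (by rw [h0, ENNReal.ofReal_zero])
    rw [(B k).support_normed_eq] at this
    simpa using this
  have hφ0 : ∀ k x, 0 ≤ φ k x := fun k x => by
    rw [hφP]; exact integral_nonneg fun h => hψ0 _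
  have hφM : ∀ k x, φ k x ≤ M := by
    intro k x
    have := hP k
    rw [hφP]
    calc ∫ h, ψ (x - h) ∂P k ≤ ∫ _h, M ∂P k := by
          refine integral_mono_of_nonneg (Eventually.of_forall fun h => hψ0 _)
            (integrable_const _) (Eventually.of_forall fun h => hM _)
      _ = M := by simp
  have hφK : ∀ k, ∀ x ∉ Metric.cthickening δ K, φ k x = 0 := by
    intro k x hx
    rw [hφP]
    refine integral_eq_zero_of_ae ?_
    filter_upwards [hPball k] with h hh
    refine hψK _ fun hmem => hx ?_
    refine Metric.mem_cthickening_of_dist_le x (x - h) δ K hmem ?_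
    rw [dist_eq_norm, sub_sub_cancel]
    exact hh.le.trans (hBle k)
  have hts : ∀ k, tsupport (φ k) ⊆ Metric.cthickening δ K := fun k =>
    closure_minimal (fun x hx => by_contra fun h => hx (hφK k x h)) Metric.isClosed_cthickening
  have hφC : ∀ k, ContDiff ℝ ∞ (φ k) := fun k =>
    (B k).hasCompactSupport_normed.contDiff_convolution_left _ (B k).contDiff_normed hloc
  refine ⟨Metric.cthickening δ K, φ, hK₁, Metric.self_subset_cthickening K, hδΩ, fun k => ⟨hφC k, ?_, (hts k).trans hδΩ, hφ0 k⟩,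
    hφM, hφK, ?_, ?_⟩
  · exact hK₁.of_isClosed_subset (isClosed_tsupport _) (hts k)
  · refine ContDiffBump.ae_convolution_tendsto_right_of_locallyIntegrable hBlim (K := 2)
      (Eventually.of_forall fun k => ?_) hloc
    have : (B k).rIn = δ / (2 * (k + 1)) := rfl
    rw [this, hBout]
    refine le_of_eq ?_
    field_simp
  · have hF : MemLp (fun q : EuclideanSpace ℝ (Fin N) × EuclideanSpace ℝ (Fin N) =>
        kernel s p q ^ (1 / p) * increment ψ q) (ENNReal.ofReal p) volume := by
      have hm : Measurable fun q : EuclideanSpace ℝ (Fin N) × EuclideanSpace ℝ (Fin N) =>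
          kernel s p q ^ (1 / p) * increment ψ q :=
        ((measurable_kernel s p).pow_const _).mul (measurable_increment hψ)
      rw [memLp_ofReal_iff hp0 hm.aestronglyMeasurable]
      rw [gagliardo_eq hp0 MeasurableSet.univ hψ, univ_prod_univ, Measure.restrict_univ,
        lintegral_kernelMeasure _ _ ((measurable_increment hψ).enorm.pow_const p)] at hψg
      refine lt_of_eq_of_lt (lintegral_congr fun q => ?_) hψg
      rw [enorm_mul, ENNReal.mul_rpow_of_nonneg _ _ hp0.le,
        Real.enorm_of_nonneg (Real.rpow_nonneg (kernel_nonneg s p q) _),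
        ENNReal.ofReal_rpow_of_nonneg (Real.rpow_nonneg (kernel_nonneg s p q) _) hp0.le,
        ← Real.rpow_mul (kernel_nonneg s p q), one_div, inv_mul_cancel₀ hp0.ne', Real.rpow_one]
    have hdiag : Tendsto (fun h : EuclideanSpace ℝ (Fin N) => (h, h)) (𝓝 0) (𝓝 0) :=
      Continuous.tendsto' (by fun_prop) _ _ rfl
    -- Continuity of translations in `L^p(ℝ^{2N})`, restricted to the diagonal shifts `(h, h)`.
    have hT := (tendsto_lintegral_sub_translate (volume.prod volume) hp.le hF).comp hdiag
    rw [ENNReal.tendsto_nhds_zero] at hT ⊢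
    intro ε hε
    obtain ⟨r, hr, hball⟩ := Metric.eventually_nhds_iff.1 (hT ε hε)
    filter_upwards [hBlim.eventually (gt_mem_nhds hr)] with k hk
    have := hP k
    refine (gagliardo_average_sub_le hp hψ (hφC k).continuous.measurable habs (P k)
      (hφP k)).trans ?_
    calc _ ≤ ∫⁻ _h, ε ∂P k := by
          refine lintegral_mono_ae ?_
          filter_upwards [hPball k] with h hh
          refine hball ?_
          rw [dist_zero_right]
          exact hh.trans hk
      _ = ε := by simp

/-! ### Cutoffs and finiteness of seminorms. -/

lemma exists_cutoff {Ω K : Set (EuclideanSpace ℝ (Fin N))} (hΩ : IsOpen Ω) (hK : IsCompact K)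
    (hKΩ : K ⊆ Ω) : ∃ χ, IsNonnegTest Ω χ ∧ ∀ x ∈ K, χ x = 1 := by
  obtain ⟨δ, hδ, hδΩ⟩ := hK.exists_cthickening_subset_open hΩ hKΩ
  obtain ⟨χ, hχ, hχr, hχs, hχ1⟩ := exists_contMDiff_support_eq_eq_one_iff (n := (⊤ : ℕ∞))
    𝓘(ℝ, EuclideanSpace ℝ (Fin N)) (Metric.isOpen_thickening (δ := δ) (E := K)) hK.isClosed
    (Metric.self_subset_thickening hδ K)
  have hts : tsupport χ ⊆ Metric.cthickening δ K := by
    rw [tsupport, hχs]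
    exact Metric.closure_thickening_subset_cthickening δ K
  exact ⟨χ, ⟨hχ.contDiff, hK.cthickening.of_isClosed_subset (isClosed_tsupport _) hts,
    hts.trans hδΩ, fun x => (hχr ⟨x, rfl⟩).1⟩, fun x hx => (hχ1 x).1 hx⟩

lemma kernel_swap (s p : ℝ) (x y : EuclideanSpace ℝ (Fin N)) :
    kernel s p (x, y) = kernel s p (y, x) := by
  simp only [kernel, norm_sub_rev]

/-- Boundedness and the Lipschitz property bound the increment by a multiple of `min(1, 2|x-y|)`,
and it vanishes unless one of the points lies in the support. The tempered kernel at scale `1` is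
then integrated over a set of finite measure. -/
lemma IsNonnegTest.gagliardo_lt_top (hN : 0 < N) {s p : ℝ} (hs0 : 0 < s) (hs1 : s < 1)
    (hp : 1 < p) {Ω : Set (EuclideanSpace ℝ (Fin N))} {χ : EuclideanSpace ℝ (Fin N) → ℝ}
    (hχ : IsNonnegTest Ω χ) : gagliardo s p univ χ < ⊤ := by
  have hp0 : 0 < p := by linarith
  have hχm : Measurable χ := hχ.contDiff.continuous.measurable
  obtain ⟨C, hC, hCle⟩ := lintegral_tempered_kernel_le hN hs0 hs1 hp
  obtain ⟨L, hL⟩ := hχ.contDiff.lipschitzWith_of_hasCompactSupport hχ.hasCompactSupport (by simp)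
  obtain ⟨B, hB⟩ := hχ.hasCompactSupport.exists_bound_of_continuous hχ.contDiff.continuous
  set S := tsupport χ
  have hS : MeasurableSet S := (isClosed_tsupport χ).measurableSet
  set D : ℝ := max (2 * B) L
  have hD : 0 ≤ D := le_max_of_le_right L.2
  have hinc : ∀ q : EuclideanSpace ℝ (Fin N) × EuclideanSpace ℝ (Fin N),
      |increment χ q| ≤ D * min 1 (2 * ‖q.1 - q.2‖ / 1) := by
    intro q
    rw [mul_min_of_nonneg _ _ hD]
    refine le_min ?_ ?_
    · have h1 := hB q.1
      have h2 := hB q.2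
      rw [Real.norm_eq_abs] at h1 h2
      calc |increment χ q| ≤ |χ q.1| + |χ q.2| := abs_sub _ _
        _ ≤ D * 1 := by have := le_max_left (2 * B) L; simp only [D]; linarith
    · have h1 := hL.dist_le_mul q.1 q.2
      rw [Real.dist_eq, dist_eq_norm] at h1
      have h2 : (L : ℝ) * ‖q.1 - q.2‖ ≤ D * ‖q.1 - q.2‖ := by gcongr; exact le_max_right _ _
      have h3 : 0 ≤ D * ‖q.1 - q.2‖ := by positivity
      simp only [increment]
      linarith
  set w : EuclideanSpace ℝ (Fin N) × EuclideanSpace ℝ (Fin N) → ℝ≥0∞ := fun q =>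
    ENNReal.ofReal (kernel s p q) * ENNReal.ofReal ((min 1 (2 * ‖q.1 - q.2‖ / 1)) ^ p) with hw
  have hwm : Measurable w :=
    (measurable_kernel s p).ennreal_ofReal.mul (Measurable.ennreal_ofReal (by fun_prop))
  have hw1 : ∀ y, ∫⁻ x, w (x, y) ≤ C := fun y => by
    have h := hCle y 1 one_pos
    rwa [Real.one_rpow, ENNReal.ofReal_one, mul_one] at h
  have hw2 : ∀ x, ∫⁻ y, w (x, y) ≤ C := fun x => by
    refine le_trans (le_of_eq ?_) (hw1 x)
    refine lintegral_congr fun y => ?_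
    simp only [hw]
    rw [kernel_swap, norm_sub_rev]
  have hle : ∀ q, ENNReal.ofReal (kernel s p q) * ‖increment χ q‖ₑ ^ p ≤
      ENNReal.ofReal (D ^ p) *
        (S.indicator 1 q.1 * w q + S.indicator 1 q.2 * w q) := by
    intro q
    have h1 : ‖increment χ q‖ₑ ^ p ≤
        ENNReal.ofReal (D ^ p) * ENNReal.ofReal ((min 1 (2 * ‖q.1 - q.2‖ / 1)) ^ p) := by
      rw [enorm_rpow_eq_ofReal hp0, ← ENNReal.ofReal_mul (by positivity),
        ← Real.mul_rpow hD (by positivity)]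
      gcongr
      exact hinc q
    have h2 : ENNReal.ofReal (kernel s p q) * ‖increment χ q‖ₑ ^ p ≤
        ENNReal.ofReal (D ^ p) * w q := by
      calc _ ≤ ENNReal.ofReal (kernel s p q) * _ := mul_le_mul_right h1 _
        _ = _ := by simp only [hw]; ring
    by_cases hx : q.1 ∈ S
    · refine h2.trans ?_
      gcongr
      simp [hx]
    · by_cases hy : q.2 ∈ S
      · refine h2.trans ?_
        gcongr
        simp [hy]
      · have : increment χ q = 0 := by
          simp [increment, image_eq_zero_of_notMem_tsupport hx,
            image_eq_zero_of_notMem_tsupport hy]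
        rw [this, enorm_zero, ENNReal.zero_rpow_of_pos hp0, mul_zero]
        exact zero_le
  have hi : Measurable (S.indicator (1 : EuclideanSpace ℝ (Fin N) → ℝ≥0∞)) :=
    measurable_one.indicator hS
  rw [gagliardo_eq hp0 MeasurableSet.univ hχm, univ_prod_univ, Measure.restrict_univ,
    lintegral_kernelMeasure _ _ ((measurable_increment hχm).enorm.pow_const p)]
  refine lt_of_le_of_lt (lintegral_mono hle) ?_
  have hm1 : Measurable fun q : EuclideanSpace ℝ (Fin N) × EuclideanSpace ℝ (Fin N) =>
      S.indicator 1 q.1 * w q := (hi.comp measurable_fst).mul hwm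
  have hm2 : Measurable fun q : EuclideanSpace ℝ (Fin N) × EuclideanSpace ℝ (Fin N) =>
      S.indicator 1 q.2 * w q := (hi.comp measurable_snd).mul hwm
  have hSfin : volume S < ⊤ := hχ.hasCompactSupport.measure_lt_top
  have hconst : ∫⁻ x, S.indicator 1 x * C = volume S * C := by
    rw [lintegral_mul_const _ hi, lintegral_indicator_one hS]
  have hfin : volume S * C < ⊤ := ENNReal.mul_lt_top hSfin (lt_top_iff_ne_top.2 hC)
  have i1 : ∫⁻ q : EuclideanSpace ℝ (Fin N) × EuclideanSpace ℝ (Fin N),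
      S.indicator 1 q.1 * w q < ⊤ := by
    refine lt_of_le_of_lt ?_ hfin
    rw [← hconst, Measure.volume_eq_prod, lintegral_prod _ hm1.aemeasurable]
    refine lintegral_mono fun x => ?_
    have hwx : Measurable fun y => w (x, y) := hwm.comp measurable_prodMk_left
    refine (lintegral_const_mul (S.indicator 1 x) hwx).trans_le ?_
    gcongr
    exact hw2 x
  have i2 : ∫⁻ q : EuclideanSpace ℝ (Fin N) × EuclideanSpace ℝ (Fin N),
      S.indicator 1 q.2 * w q < ⊤ := by
    refine lt_of_le_of_lt ?_ hfin
    rw [← hconst, Measure.volume_eq_prod, lintegral_prod_symm _ hm2.aemeasurable]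
    refine lintegral_mono fun y => ?_
    have hwy : Measurable fun x => w (x, y) := hwm.comp measurable_prodMk_right
    refine (lintegral_const_mul (S.indicator 1 y) hwy).trans_le ?_
    gcongr
    exact hw1 y
  have hm12 : Measurable fun q : EuclideanSpace ℝ (Fin N) × EuclideanSpace ℝ (Fin N) =>
      S.indicator 1 q.1 * w q + S.indicator 1 q.2 * w q := hm1.add hm2
  rw [lintegral_const_mul _ hm12, lintegral_add_left hm1]
  exact ENNReal.mul_lt_top ENNReal.ofReal_lt_top (ENNReal.add_lt_top.2 ⟨i1, i2⟩)

/-- Away from the square of its support, a cutoff dominates the increments of the bounded functions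
supported where it equals `1`. -/
lemma abs_increment_le_of_cutoff {K : Set (EuclideanSpace ℝ (Fin N))}
    {χ g : EuclideanSpace ℝ (Fin N) → ℝ} {M : ℝ} (hχ0 : ∀ x, 0 ≤ χ x) (hχ1 : ∀ x ∈ K, χ x = 1)
    (hg0 : ∀ x, 0 ≤ g x) (hgM : ∀ x, g x ≤ M) (hgK : ∀ x ∉ K, g x = 0)
    {q : EuclideanSpace ℝ (Fin N) × EuclideanSpace ℝ (Fin N)}
    (hq : q ∉ tsupport χ ×ˢ tsupport χ) : |increment g q| ≤ M * |increment χ q| := by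
  have hM : 0 ≤ M := (hg0 0).trans (hgM 0)
  have hle : ∀ x, g x ≤ M * χ x := by
    intro x
    by_cases hx : x ∈ K
    · rw [hχ1 x hx, mul_one]; exact hgM x
    · rw [hgK x hx]; exact mul_nonneg hM (hχ0 x)
  have hz : ∀ x, χ x = 0 → g x = 0 := fun x hx =>
    hgK x fun hxK => by rw [hχ1 x hxK] at hx; exact one_ne_zero hx
  by_cases h1 : q.1 ∈ tsupport χ
  · have h2 : χ q.2 = 0 := image_eq_zero_of_notMem_tsupport fun h2 => hq ⟨h1, h2⟩
    simp only [increment, h2, hz _ h2, sub_zero, abs_of_nonneg (hg0 _), abs_of_nonneg (hχ0 _)]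
    exact hle _
  · have h2 : χ q.1 = 0 := image_eq_zero_of_notMem_tsupport h1
    simp only [increment, h2, hz _ h2, zero_sub, abs_neg, abs_of_nonneg (hg0 _),
      abs_of_nonneg (hχ0 _)]
    exact hle _

/-! ### Hölder estimates and the enlarged class of test functions. -/

lemma memLp_signedPow {α : Type*} [MeasurableSpace α] {μ : Measure α} {p : ℝ} (hp : 1 < p)
    {F : α → ℝ} (hF : MemLp F (ENNReal.ofReal p) μ) :
    MemLp (fun q => signedPow p (F q)) (ENNReal.ofReal (p / (p - 1))) μ := by
  have hp1 : 0 < p - 1 := by linarith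
  have hp0 : 0 < p := by linarith
  have h := (memLp_ofReal_iff hp0 hF.1).1 hF
  rw [memLp_ofReal_iff (by positivity) ((continuous_signedPow hp).comp_aestronglyMeasurable hF.1)]
  refine lt_of_eq_of_lt (lintegral_congr fun q => ?_) h
  rw [enorm_rpow_eq_ofReal (by positivity), enorm_rpow_eq_ofReal hp0, abs_signedPow hp,
    ← Real.rpow_mul (abs_nonneg _)]
  congr 2
  field_simp

lemma holderConjugate_of_one_lt {p : ℝ} (hp : 1 < p) : (p / (p - 1)).HolderConjugate p :=
  (Real.HolderConjugate.conjExponent hp).symm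

lemma lintegral_enorm_mul_le {α : Type*} [MeasurableSpace α] {μ : Measure α} {p : ℝ} (hp : 1 < p)
    {F G : α → ℝ} (hF : AEStronglyMeasurable F μ) (hG : AEStronglyMeasurable G μ) :
    ∫⁻ q, ‖F q * G q‖ₑ ∂μ ≤ (∫⁻ q, ‖F q‖ₑ ^ (p / (p - 1)) ∂μ) ^ (1 / (p / (p - 1))) *
      (∫⁻ q, ‖G q‖ₑ ^ p ∂μ) ^ (1 / p) := by
  simp_rw [enorm_mul]
  exact ENNReal.lintegral_mul_le_Lp_mul_Lq μ (holderConjugate_of_one_lt hp) hF.enorm hG.enorm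

lemma integrable_signedPow_mul {α : Type*} [MeasurableSpace α] {μ : Measure α} {p : ℝ} (hp : 1 < p)
    {F G : α → ℝ} (hF : MemLp F (ENNReal.ofReal p) μ) (hG : MemLp G (ENNReal.ofReal p) μ) :
    Integrable (fun q => signedPow p (F q) * G q) μ := by
  have hp1 : 0 < p - 1 := by linarith
  have hp0 : 0 < p := by linarith
  have hJ := memLp_signedPow hp hF
  refine ⟨hJ.1.mul hG.1, ?_⟩
  refine lt_of_le_of_lt (lintegral_enorm_mul_le hp hJ.1 hG.1) (ENNReal.mul_lt_top ?_ ?_)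
  · exact ENNReal.rpow_lt_top_of_nonneg (by positivity)
      ((memLp_ofReal_iff (by positivity) hJ.1).1 hJ).ne
  · exact ENNReal.rpow_lt_top_of_nonneg (by positivity) ((memLp_ofReal_iff hp0 hG.1).1 hG).ne

lemma tendsto_integral_signedPow_mul {α : Type*} [MeasurableSpace α] {μ : Measure α} {p : ℝ}
    (hp : 1 < p) {F G : α → ℝ} {H : ℕ → α → ℝ} (hF : MemLp F (ENNReal.ofReal p) μ)
    (hG : MemLp G (ENNReal.ofReal p) μ) (hH : ∀ k, MemLp (H k) (ENNReal.ofReal p) μ)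
    (hlim : Tendsto (fun k => ∫⁻ q, ‖H k q - G q‖ₑ ^ p ∂μ) atTop (𝓝 0)) :
    Tendsto (fun k => ∫ q, signedPow p (F q) * H k q ∂μ) atTop
      (𝓝 (∫ q, signedPow p (F q) * G q ∂μ)) := by
  have hp1 : 0 < p - 1 := by linarith
  have hp0 : 0 < p := by linarith
  have hJ := memLp_signedPow hp hF
  refine tendsto_integral_of_L1 _ (integrable_signedPow_mul hp hF hG).1
    (Eventually.of_forall fun k => integrable_signedPow_mul hp hF (hH k)) ?_
  have hJfin := ENNReal.rpow_lt_top_of_nonneg (y := 1 / (p / (p - 1))) (by positivity)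
      ((memLp_ofReal_iff (by positivity) hJ.1).1 hJ).ne
  have h1 : Tendsto (fun k => (∫⁻ q, ‖H k q - G q‖ₑ ^ p ∂μ) ^ (1 / p)) atTop (𝓝 0) := by
    have := (ENNReal.continuous_rpow_const (y := 1 / p)).tendsto 0 |>.comp hlim
    rwa [ENNReal.zero_rpow_of_pos (by positivity)] at this
  have h2 := ENNReal.Tendsto.const_mul h1 (Or.inr hJfin.ne)
  rw [mul_zero] at h2
  refine tendsto_of_tendsto_of_tendsto_of_le_of_le tendsto_const_nhds h2 (fun _ => zero_le)
    fun k => ?_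
  simp_rw [← mul_sub]
  exact lintegral_enorm_mul_le hp hJ.1 ((hH k).1.sub hG.1)

lemma memLp_increment_univ_iff {s p : ℝ} (hp : 0 < p) {u : EuclideanSpace ℝ (Fin N) → ℝ}
    (hu : Measurable u) :
    MemLp (increment u) (ENNReal.ofReal p) (kernelMeasure N s p) ↔ gagliardo s p univ u < ⊤ := by
  rw [← memLp_increment_iff hp MeasurableSet.univ hu, univ_prod_univ, Measure.restrict_univ]

/-- On the square of the support of a cutoff, the local seminorm of `v` suffices, as the positive
part is `1`-Lipschitz. Off that square, the increment is dominated by that of the cutoff, whatever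
`v` does. -/
lemma gagliardo_posPart_sub_lt_top (hN : 0 < N) {s p : ℝ} (hs0 : 0 < s) (hs1 : s < 1)
    (hp : 1 < p) {Ω K : Set (EuclideanSpace ℝ (Fin N))} (hΩ : IsOpen Ω) (hK : IsCompact K)
    (hKΩ : K ⊆ Ω) {w v : EuclideanSpace ℝ (Fin N) → ℝ} (hw : Measurable w) (hv : Measurable v)
    (hwg : gagliardo s p univ w < ⊤) (hvloc : MemWloc s p Ω v) {M : ℝ}
    (hM : ∀ x, max (w x - v x) 0 ≤ M) (hψK : ∀ x ∉ K, max (w x - v x) 0 = 0) :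
    gagliardo s p univ (fun x => max (w x - v x) 0) < ⊤ := by
  have hp0 : 0 < p := by linarith
  obtain ⟨χ, hχ, hχ1⟩ := exists_cutoff hΩ hK hKΩ
  have hχm : Measurable χ := hχ.contDiff.continuous.measurable
  set ψ : EuclideanSpace ℝ (Fin N) → ℝ := fun x => max (w x - v x) 0 with hψdef
  have hψ : Measurable ψ := (hw.sub hv).max measurable_const
  have hT : MeasurableSet (tsupport χ) := (isClosed_tsupport χ).measurableSet
  set A := tsupport χ ×ˢ tsupport χ with hA
  have hAm : MeasurableSet A := hT.prod hT
  have hw' := (memLp_increment_univ_iff hp0 hw).2 hwg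
  have hv' := (memLp_increment_iff hp0 hT hv).2
    (hvloc _ hχ.hasCompactSupport hχ.tsupport_subset).2
  have hon : MemLp (increment ψ) (ENNReal.ofReal p) ((kernelMeasure N s p).restrict A) := by
    refine ((hw'.restrict A).norm.add hv'.norm).mono' (measurable_increment hψ).aestronglyMeasurable
      (Eventually.of_forall fun q => ?_)
    have h1 : |max (w q.1 - v q.1) 0 - max (w q.2 - v q.2) 0| ≤
        |(w q.1 - v q.1) - (w q.2 - v q.2)| := abs_max_sub_max_le_abs _ _ _
    have h2 : (w q.1 - v q.1) - (w q.2 - v q.2) = increment w q - increment v q := by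
      simp only [increment]; ring
    rw [h2] at h1
    exact h1.trans (abs_sub _ _)
  have hoff : MemLp (increment ψ) (ENNReal.ofReal p) ((kernelMeasure N s p).restrict Aᶜ) := by
    have hχ' := (memLp_increment_univ_iff (s := s) hp0 hχm).2
      (hχ.gagliardo_lt_top hN hs0 hs1 hp)
    refine ((hχ'.restrict Aᶜ).norm.const_mul M).mono' (measurable_increment hψ).aestronglyMeasurable
      ?_
    filter_upwards [ae_restrict_mem hAm.compl] with q hq
    exact abs_increment_le_of_cutoff hχ.nonneg hχ1 (fun x => le_max_right _ _) hM hψK hq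
  rw [gagliardo_eq hp0 MeasurableSet.univ hψ, univ_prod_univ, Measure.restrict_univ,
    ← lintegral_add_compl _ hAm]
  exact ENNReal.add_lt_top.2 ⟨(memLp_ofReal_iff hp0 hon.1).1 hon, (memLp_ofReal_iff hp0 hoff.1).1 hoff⟩

lemma ae_tendsto_increment {s p : ℝ} {φ : ℕ → EuclideanSpace ℝ (Fin N) → ℝ}
    {ψ : EuclideanSpace ℝ (Fin N) → ℝ}
    (h : ∀ᵐ x, Tendsto (fun k => φ k x) atTop (𝓝 (ψ x))) :
    ∀ᵐ q ∂kernelMeasure N s p, Tendsto (fun k => increment (φ k) q) atTop (𝓝 (increment ψ q)) := by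
  refine (kernelMeasure_absolutelyContinuous s p).ae_le ?_
  rw [Measure.volume_eq_prod]
  filter_upwards [Measure.quasiMeasurePreserving_fst.ae h,
    Measure.quasiMeasurePreserving_snd.ae h] with q h1 h2
  exact h1.sub h2

lemma aemeasurable_singularTerm {γ : ℝ} {Ω : Set (EuclideanSpace ℝ (Fin N))}
    {f z : EuclideanSpace ℝ (Fin N) → ℝ} (hf : IntegrableOn f Ω volume) (hz : Measurable z) :
    AEMeasurable (singularTerm γ f z) (volume.restrict Ω) := by
  unfold singularTerm
  exact hf.aemeasurable.ennreal_ofReal.div (hz.ennreal_ofReal.pow_const γ).aemeasurable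

/-- The two sides of the weak formulation are continuous along suitable approximations by test
functions. -/
lemma IsAdmissible.exists_nonnegTest_seq (hN : 0 < N) {s p γ : ℝ} (hs0 : 0 < s) (hs1 : s < 1)
    (hp : 1 < p) {Ω K : Set (EuclideanSpace ℝ (Fin N))} (hΩ : IsOpen Ω) (hK : IsCompact K)
    (hKΩ : K ⊆ Ω) {f z : EuclideanSpace ℝ (Fin N) → ℝ} (hf : IntegrableOn f Ω volume)
    (hz : IsAdmissible s p γ Ω f z) (hzm : Measurable z)
    {ψ : EuclideanSpace ℝ (Fin N) → ℝ} (hψ : Measurable ψ) (hψ0 : ∀ x, 0 ≤ ψ x) {M : ℝ}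
    (hM : ∀ x, ψ x ≤ M) (hψK : ∀ x ∉ K, ψ x = 0) (hψg : gagliardo s p univ ψ < ⊤) :
    Integrable (fun q => signedPow p (increment z q) * increment ψ q) (kernelMeasure N s p) ∧
    IntegrableOn (fun x => (singularTerm γ f z x).toReal * ψ x) Ω ∧
    ∃ φ : ℕ → EuclideanSpace ℝ (Fin N) → ℝ, (∀ k, IsNonnegTest Ω (φ k)) ∧
      Tendsto (fun k => ∫ q, formIntegrand s p z (φ k) q) atTop
        (𝓝 (∫ q, signedPow p (increment z q) * increment ψ q ∂kernelMeasure N s p)) ∧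
      Tendsto (fun k => ∫ x in Ω, (singularTerm γ f z x).toReal * φ k x) atTop
        (𝓝 (∫ x in Ω, (singularTerm γ f z x).toReal * ψ x)) := by
  have hp0 : 0 < p := by linarith
  have hM0 : 0 ≤ M := (hψ0 0).trans (hM 0)
  obtain ⟨K₁, φ, hK₁, hKK₁, hK₁Ω, hφ, hφM, hφK, hφae, hφg⟩ :=
    FracPLap.exists_nonnegTest_seq hp hΩ hK hKΩ hψ hψ0 hM hψK hψg
  have hψK₁ : ∀ x ∉ K₁, ψ x = 0 := fun x hx => hψK x fun h => hx (hKK₁ h)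
  -- The cutoff equals `1` on `K₁`, not merely on `K`, so that it dominates `ψ` and all its
  -- approximations at once.
  obtain ⟨χ, hχ, hχ1⟩ := exists_cutoff hΩ hK₁ hK₁Ω
  have hT : MeasurableSet (tsupport χ) := (isClosed_tsupport χ).measurableSet
  set A := tsupport χ ×ˢ tsupport χ with hA
  have hAm : MeasurableSet A := hT.prod hT
  set ν := kernelMeasure N s p with hν
  have hφm : ∀ k, Measurable (φ k) := fun k => (hφ k).contDiff.continuous.measurable
  have hJm : Measurable fun q => signedPow p (increment z q) :=
    (continuous_signedPow hp).measurable.comp (measurable_increment hzm)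
  have hz' : MemLp (increment z) (ENNReal.ofReal p) (ν.restrict A) :=
    (memLp_increment_iff hp0 hT hzm).2 (hz.memWloc _ hχ.hasCompactSupport hχ.tsupport_subset).2
  have hψ' : MemLp (increment ψ) (ENNReal.ofReal p) ν := (memLp_increment_univ_iff hp0 hψ).2 hψg
  have hφ' : ∀ k, MemLp (increment (φ k)) (ENNReal.ofReal p) ν := fun k =>
    (memLp_increment_univ_iff hp0 (hφm k)).2 ((hφ k).gagliardo_lt_top hN hs0 hs1 hp)
  have hform : ∀ g, IsNonnegTest Ω g →
      Integrable (fun q => signedPow p (increment z q) * increment g q) ν := fun g hg =>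
    (integrable_formIntegrand_iff s p z g).1 (hz.integrable_form g hg)
  -- Off `A`, the increments of `z` need not be in `L^p`. The majorant comes instead from the
  -- absolute convergence of the form for the single test function `χ`.
  have hbound : Integrable (fun q => M * ‖signedPow p (increment z q) * increment χ q‖)
      (ν.restrict Aᶜ) := (hform χ hχ).norm.integrableOn.const_mul M
  have hdom : ∀ g : EuclideanSpace ℝ (Fin N) → ℝ, (∀ x, 0 ≤ g x) → (∀ x, g x ≤ M) →
      (∀ x ∉ K₁, g x = 0) → ∀ᵐ q ∂ν.restrict Aᶜ, ‖signedPow p (increment z q) * increment g q‖ ≤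
        M * ‖signedPow p (increment z q) * increment χ q‖ := by
    intro g hg0 hgM hgK
    filter_upwards [ae_restrict_mem hAm.compl] with q hq
    have := abs_increment_le_of_cutoff hχ.nonneg hχ1 hg0 hgM hgK hq
    rw [norm_mul, norm_mul, Real.norm_eq_abs (increment g q), Real.norm_eq_abs (increment χ q)]
    calc _ ≤ ‖signedPow p (increment z q)‖ * (M * |increment χ q|) := by gcongr
      _ = _ := by ring
  have hon : IntegrableOn (fun q => signedPow p (increment z q) * increment ψ q) A ν :=
    integrable_signedPow_mul hp hz' (hψ'.restrict A)
  have hoff : IntegrableOn (fun q => signedPow p (increment z q) * increment ψ q) Aᶜ ν :=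
    hbound.mono' (hJm.mul (measurable_increment hψ)).aestronglyMeasurable (hdom ψ hψ0 hM hψK₁)
  have hint : Integrable (fun q => signedPow p (increment z q) * increment ψ q) ν := by
    rw [← integrableOn_univ, ← union_compl_self A]
    exact hon.union hoff
  have hsing : Integrable (K₁.indicator fun x => (singularTerm γ f z x).toReal * M)
      (volume.restrict Ω) := by
    rw [integrable_indicator_iff hK₁.measurableSet, IntegrableOn,
      Measure.restrict_restrict hK₁.measurableSet, inter_eq_left.2 hK₁Ω]
    refine Integrable.mul_const ?_ M
    exact integrable_toReal_of_lintegral_ne_top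
      ((aemeasurable_singularTerm hf hzm).mono_measure (Measure.restrict_mono hK₁Ω le_rfl))
      (hz.locallyIntegrable_singularTerm K₁ hK₁ hK₁Ω).ne
  have hsdom : ∀ g : EuclideanSpace ℝ (Fin N) → ℝ, (∀ x, 0 ≤ g x) → (∀ x, g x ≤ M) →
      (∀ x ∉ K₁, g x = 0) → ∀ x, ‖(singularTerm γ f z x).toReal * g x‖ ≤
        K₁.indicator (fun x => (singularTerm γ f z x).toReal * M) x := by
    intro g hg0 hgM hgK x
    by_cases hx : x ∈ K₁
    · rw [indicator_of_mem hx, norm_mul, Real.norm_of_nonneg ENNReal.toReal_nonneg,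
        Real.norm_of_nonneg (hg0 x)]
      gcongr
      exact hgM x
    · rw [indicator_of_notMem hx, hgK x hx, mul_zero, norm_zero]
  have hsm : AEStronglyMeasurable (fun x => (singularTerm γ f z x).toReal) (volume.restrict Ω) :=
    (aemeasurable_singularTerm hf hzm).ennreal_toReal.aestronglyMeasurable
  refine ⟨hint, hsing.mono' (hsm.mul hψ.aestronglyMeasurable)
    (Eventually.of_forall (hsdom ψ hψ0 hM hψK₁)), φ, hφ, ?_, ?_⟩
  · simp_rw [integral_formIntegrand]
    rw [← integral_add_compl hAm hint]
    refine Tendsto.congr (fun k => integral_add_compl hAm (hform (φ k) (hφ k)))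
      (Tendsto.add ?_ ?_)
    · refine tendsto_integral_signedPow_mul hp hz' (hψ'.restrict A) (fun k => (hφ' k).restrict A) ?_
      refine tendsto_of_tendsto_of_tendsto_of_le_of_le tendsto_const_nhds hφg (fun _ => zero_le)
        fun k => ?_
      have hsub : Measurable fun x => φ k x - ψ x := (hφm k).sub hψ
      rw [gagliardo_eq hp0 MeasurableSet.univ hsub, univ_prod_univ, Measure.restrict_univ]
      refine (setLIntegral_le_lintegral A _).trans (lintegral_mono fun q => le_of_eq ?_)
      have : increment (φ k) q - increment ψ q = increment (fun x => φ k x - ψ x) q := by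
        simp only [increment]; ring
      rw [this]
    · refine tendsto_integral_of_dominated_convergence _
        (fun k => (hJm.mul (measurable_increment (hφm k))).aestronglyMeasurable) hbound
        (fun k => hdom (φ k) (hφ k).nonneg (hφM k) (hφK k)) ?_
      filter_upwards [ae_restrict_of_ae (ae_tendsto_increment hφae)] with q hq
      exact hq.const_mul _
  · refine tendsto_integral_of_dominated_convergence _
      (fun k => hsm.mul (hφm k).aestronglyMeasurable) hsing
      (fun k => Eventually.of_forall (hsdom (φ k) (hφ k).nonneg (hφM k) (hφK k))) ?_
    filter_upwards [ae_restrict_of_ae hφae] with x hx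
    exact hx.const_mul _

/-! ### Passage to the limit by monotonicity. -/

/-- A monotonicity argument: if `D_n = (J(U_n) - J(V)) Ψ_n ≥ 0` controls `|Ψ_n|^p`, and `U_n → U` in
`L^p` where `∫ J(U) Ψ_n ≤ ∫ J(V) Ψ_n`, then `D_n` tends to `0` in the mean. -/
lemma ae_signedPow_sub_mul_nonpos {α : Type*} [MeasurableSpace α] {ν : Measure α} {p : ℝ}
    (hp : 1 < p) {U V Ψ G : α → ℝ} {Un Ψn : ℕ → α → ℝ} (hV : Measurable V)
    (hUn : ∀ n, Measurable (Un n)) (hΨnm : ∀ n, Measurable (Ψn n))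
    (hG : MemLp G (ENNReal.ofReal p) ν) (hUG : ∀ n q, |Un n q| ≤ G q)
    (hUlim : ∀ q, Tendsto (fun n => Un n q) atTop (𝓝 (U q)))
    (hΨlim : ∀ q, Tendsto (fun n => Ψn n q) atTop (𝓝 (Ψ q)))
    (hΨn : ∀ n, MemLp (Ψn n) (ENNReal.ofReal p) ν)
    (hVΨ : ∀ n, Integrable (fun q => signedPow p (V q) * Ψn n q) ν) {C : ℝ} (hC : 0 < C)
    (hD : ∀ n q, 0 ≤ (signedPow p (Un n q) - signedPow p (V q)) * Ψn n q)
    (hCD : ∀ n q, |Ψn n q| ^ p ≤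
      C * ((signedPow p (Un n q) - signedPow p (V q)) * Ψn n q + |Un n q| ^ p))
    (hle : ∀ n, ∫ q, signedPow p (U q) * Ψn n q ∂ν ≤ ∫ q, signedPow p (V q) * Ψn n q ∂ν) :
    ∀ᵐ q ∂ν, (signedPow p (U q) - signedPow p (V q)) * Ψ q ≤ 0 := by
  have hp0 : 0 < p := by linarith
  have hp1 : 0 < p - 1 := by linarith
  set p' := p / (p - 1) with hp'
  have hp'0 : 0 < p' := by positivity
  have hJc := continuous_signedPow hp
  have hUGlim : ∀ q, |U q| ≤ G q := fun q =>
    le_of_tendsto (hUlim q).abs (Eventually.of_forall fun n => hUG n q)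
  have hG0 : ∀ q, 0 ≤ G q := fun q => (abs_nonneg _).trans (hUGlim q)
  have hUm : Measurable U := measurable_of_tendsto_metrizable hUn (tendsto_pi_nhds.2 hUlim)
  have hUL : MemLp U (ENNReal.ofReal p) ν :=
    hG.mono' hUm.aestronglyMeasurable (Eventually.of_forall hUGlim)
  have hUnL : ∀ n, MemLp (Un n) (ENNReal.ofReal p) ν := fun n =>
    hG.mono' (hUn n).aestronglyMeasurable (Eventually.of_forall (hUG n))
  have hrpow : ∀ {F : α → ℝ}, MemLp F (ENNReal.ofReal p) ν → Integrable (fun q => |F q| ^ p) ν := by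
    intro F hF
    have := hF.integrable_norm_rpow (ENNReal.ofReal_pos.2 hp0).ne' ENNReal.ofReal_ne_top
    simpa [ENNReal.toReal_ofReal hp0.le] using this
  have hGint := hrpow hG
  set B := ∫ q, |G q| ^ p ∂ν with hB
  have hB0 : 0 ≤ B := integral_nonneg fun q => by positivity
  -- The `L^{p'}` distance between `J(U_n)` and `J(U)`; it tends to `0` by domination with `G`.
  set δ : ℕ → ℝ := fun n =>
    (∫ q, ‖signedPow p (Un n q) - signedPow p (U q)‖ ^ p' ∂ν) ^ (1 / p') with hδ
  have hδ0 : ∀ n, 0 ≤ δ n := fun n =>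
    Real.rpow_nonneg (integral_nonneg fun q => by positivity) _
  have hδlim : Tendsto δ atTop (𝓝 0) := by
    have h1 : Tendsto (fun n => ∫ q, ‖signedPow p (Un n q) - signedPow p (U q)‖ ^ p' ∂ν) atTop
        (𝓝 (∫ _q, (0 : ℝ) ∂ν)) := by
      refine tendsto_integral_of_dominated_convergence (fun q => 2 ^ p' * |G q| ^ p)
        (fun n => ?_) (hGint.const_mul _) (fun n => Eventually.of_forall fun q => ?_)
        (Eventually.of_forall fun q => ?_)
      · exact (((hJc.measurable.comp (hUn n)).sub (hJc.measurable.comp hUm)).norm.pow_const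
          p').aestronglyMeasurable
      · rw [Real.norm_of_nonneg (by positivity)]
        have h2 : ‖signedPow p (Un n q) - signedPow p (U q)‖ ≤ 2 * |G q| ^ (p - 1) := by
          have ha : |signedPow p (Un n q)| ≤ |G q| ^ (p - 1) := by
            rw [abs_signedPow hp]
            exact Real.rpow_le_rpow (abs_nonneg _) ((hUG n q).trans (le_abs_self _)) hp1.le
          have hb : |signedPow p (U q)| ≤ |G q| ^ (p - 1) := by
            rw [abs_signedPow hp]
            exact Real.rpow_le_rpow (abs_nonneg _) ((hUGlim q).trans (le_abs_self _)) hp1.le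
          calc _ ≤ |signedPow p (Un n q)| + |signedPow p (U q)| := abs_sub _ _
            _ ≤ _ := by linarith
        calc _ ≤ (2 * |G q| ^ (p - 1)) ^ p' := Real.rpow_le_rpow (norm_nonneg _) h2 hp'0.le
          _ = _ := by
            rw [Real.mul_rpow (by norm_num) (by positivity), ← Real.rpow_mul (abs_nonneg _)]
            congr 2
            rw [hp']; field_simp
      · have h3 : Tendsto (fun n => signedPow p (Un n q) - signedPow p (U q)) atTop (𝓝 0) := by
          have := ((hJc.tendsto (U q)).comp (hUlim q)).sub_const (signedPow p (U q))
          rwa [sub_self] at this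
        have h4 := h3.norm.rpow_const (p := p') (Or.inr hp'0.le)
        rwa [norm_zero, Real.zero_rpow hp'0.ne'] at h4
    rw [integral_zero] at h1
    have h2 := h1.rpow_const (p := 1 / p') (Or.inr (by positivity))
    rwa [Real.zero_rpow (by positivity)] at h2
  set D : ℕ → α → ℝ := fun n q => (signedPow p (Un n q) - signedPow p (V q)) * Ψn n q with hDdef
  have hDint : ∀ n, Integrable (D n) ν := fun n => by
    have := (integrable_signedPow_mul hp (hUnL n) (hΨn n)).sub (hVΨ n)
    refine this.congr (Eventually.of_forall fun q => ?_)
    simp only [hDdef, Pi.sub_apply]; ring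
  set X : ℕ → ℝ := fun n => ∫ q, ‖Ψn n q‖ ^ p ∂ν with hX
  have hX0 : ∀ n, 0 ≤ X n := fun n => integral_nonneg fun q => by positivity
  -- By `hle`, replacing `J(V)` by `J(U)` in the integral of `D_n` can only increase it; Hölder then
  -- applies to `J(U_n) - J(U)`.
  have hI : ∀ n, ∫ q, D n q ∂ν ≤ δ n * X n ^ (1 / p) := by
    intro n
    have i1 := integrable_signedPow_mul hp (hUnL n) (hΨn n)
    have i2 := integrable_signedPow_mul hp hUL (hΨn n)
    have hsub := (memLp_signedPow hp (hUnL n)).sub (memLp_signedPow hp hUL)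
    have e1 : ∫ q, D n q ∂ν = ∫ q, signedPow p (Un n q) * Ψn n q ∂ν -
        ∫ q, signedPow p (V q) * Ψn n q ∂ν := by
      rw [← integral_sub i1 (hVΨ n)]
      refine integral_congr_ae (Eventually.of_forall fun q => ?_)
      simp only [hDdef]; ring
    have e2 : ∫ q, (signedPow p (Un n q) - signedPow p (U q)) * Ψn n q ∂ν =
        ∫ q, signedPow p (Un n q) * Ψn n q ∂ν - ∫ q, signedPow p (U q) * Ψn n q ∂ν := by
      rw [← integral_sub i1 i2]
      refine integral_congr_ae (Eventually.of_forall fun q => ?_)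
      ring
    calc ∫ q, D n q ∂ν ≤ ∫ q, (signedPow p (Un n q) - signedPow p (U q)) * Ψn n q ∂ν := by
          rw [e1, e2]; linarith [hle n]
      _ ≤ ‖∫ q, (signedPow p (Un n q) - signedPow p (U q)) * Ψn n q ∂ν‖ := le_abs_self _
      _ ≤ ∫ q, ‖(signedPow p (Un n q) - signedPow p (U q)) * Ψn n q‖ ∂ν :=
          norm_integral_le_integral_norm _
      _ = ∫ q, ‖signedPow p (Un n q) - signedPow p (U q)‖ * ‖Ψn n q‖ ∂ν := by simp_rw [norm_mul]
      _ ≤ _ := integral_mul_norm_le_Lp_mul_Lq (holderConjugate_of_one_lt hp) hsub (hΨn n)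
  have hXle : ∀ n, X n ≤ C * (∫ q, D n q ∂ν + B) := by
    intro n
    have hi : Integrable (fun q => D n q + |G q| ^ p) ν := (hDint n).add hGint
    rw [hB, ← integral_add (hDint n) hGint, ← integral_const_mul]
    refine integral_mono (hrpow (hΨn n)) (hi.const_mul C) fun q => (hCD n q).trans ?_
    have : |Un n q| ^ p ≤ |G q| ^ p :=
      Real.rpow_le_rpow (abs_nonneg _) ((hUG n q).trans (le_abs_self _)) hp0.le
    have hd : D n q = (signedPow p (Un n q) - signedPow p (V q)) * Ψn n q := rfl
    rw [← hd]
    gcongr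
  -- This linear bound turns the two estimates into `X_n ≤ C (δ_n (1 + X_n) + B)`, where `X_n` is
  -- absorbed on the left once `C δ_n ≤ 1/2`.
  have hroot : ∀ n, X n ^ (1 / p) ≤ 1 + X n := by
    intro n
    calc X n ^ (1 / p) ≤ (1 + X n) ^ (1 / p) :=
          Real.rpow_le_rpow (hX0 n) (by linarith) (by positivity)
      _ ≤ (1 + X n) ^ (1 : ℝ) := by
          refine Real.rpow_le_rpow_of_exponent_le (by linarith [hX0 n]) ?_
          rw [div_le_one hp0]; exact hp.le
      _ = 1 + X n := Real.rpow_one _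
  have hsmall : ∀ᶠ n in atTop, C * δ n ≤ 1 / 2 := by
    have := hδlim.const_mul C
    rw [mul_zero] at this
    exact (this.eventually (gt_mem_nhds (by norm_num : (0 : ℝ) < 1 / 2))).mono fun n h => h.le
  have hIlim : Tendsto (fun n => ∫ q, D n q ∂ν) atTop (𝓝 0) := by
    have hup : Tendsto (fun n => δ n * (2 + 2 * C * B)) atTop (𝓝 0) := by
      have := hδlim.mul_const (2 + 2 * C * B)
      rwa [zero_mul] at this
    refine tendsto_of_tendsto_of_tendsto_of_le_of_le' tendsto_const_nhds hup
      (Eventually.of_forall fun n => integral_nonneg (hD n)) ?_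
    filter_upwards [hsmall] with n hn
    have h1 : X n ≤ C * (δ n * (1 + X n) + B) := by
      refine (hXle n).trans ?_
      gcongr
      exact (hI n).trans (mul_le_mul_of_nonneg_left (hroot n) (hδ0 n))
    have h2 : X n ≤ 1 + 2 * C * B := by
      have : C * δ n * (1 + X n) ≤ 1 / 2 * (1 + X n) :=
        mul_le_mul_of_nonneg_right hn (by linarith [hX0 n])
      nlinarith
    calc ∫ q, D n q ∂ν ≤ δ n * X n ^ (1 / p) := hI n
      _ ≤ δ n * (2 + 2 * C * B) := by
          refine mul_le_mul_of_nonneg_left ?_ (hδ0 n)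
          linarith [hroot n]
  have hDm : ∀ n, Measurable (D n) := fun n =>
    ((hJc.measurable.comp (hUn n)).sub (hJc.measurable.comp hV)).mul (hΨnm n)
  have hDlim : ∀ q, Tendsto (fun n => D n q) atTop
      (𝓝 ((signedPow p (U q) - signedPow p (V q)) * Ψ q)) := fun q =>
    (((hJc.tendsto (U q)).comp (hUlim q)).sub_const _).mul (hΨlim q)
  -- Fatou rather than domination: `D_n ≥ 0`, but its part containing `J(V)` has no majorant uniform
  -- in `n`.
  have hfatou : ∫⁻ q, ENNReal.ofReal ((signedPow p (U q) - signedPow p (V q)) * Ψ q) ∂ν = 0 := by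
    rw [← nonpos_iff_eq_zero]
    calc _ = ∫⁻ q, liminf (fun n => ENNReal.ofReal (D n q)) atTop ∂ν := by
          refine lintegral_congr fun q => ?_
          exact ((ENNReal.continuous_ofReal.tendsto _).comp (hDlim q)).liminf_eq.symm
      _ ≤ liminf (fun n => ∫⁻ q, ENNReal.ofReal (D n q) ∂ν) atTop :=
          lintegral_liminf_le fun n => (hDm n).ennreal_ofReal
      _ = liminf (fun n => ENNReal.ofReal (∫ q, D n q ∂ν)) atTop := by
          congr 1
          funext n
          rw [ofReal_integral_eq_lintegral_ofReal (hDint n) (Eventually.of_forall (hD n))]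
      _ = 0 := by
          have := (ENNReal.continuous_ofReal.tendsto 0).comp hIlim
          rw [ENNReal.ofReal_zero] at this
          exact this.liminf_eq
  have hDlm : Measurable fun q => (signedPow p (U q) - signedPow p (V q)) * Ψ q :=
    measurable_of_tendsto_metrizable hDm (tendsto_pi_nhds.2 hDlim)
  filter_upwards [(lintegral_eq_zero_iff hDlm.ennreal_ofReal).1 hfatou] with q hq
  exact ENNReal.ofReal_eq_zero.1 hq

/-! ### Truncation in height and near the boundary. -/

lemma abs_min_sub_min_le_abs_sub (a b c : ℝ) : |min a c - min b c| ≤ |a - b| := by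
  simpa using abs_min_sub_min_le_max a c b c

/-- The ramp equal to `0` on `[0, 1]` and to `1` on `[2, ∞)` has a scale-invariant modulus of
continuity. -/
lemma abs_ramp_sub_le {a b : ℝ} (ha : 0 ≤ a) (hb : 0 < b) :
    |min 1 (max 0 (a - 1)) - min 1 (max 0 (b - 1))| ≤ 2 * |a - b| / b := by
  rw [le_div_iff₀ hb]
  -- For `b ≤ 2` the ramp is `1`-Lipschitz and `2 / b ≥ 1`. For `b > 2` its value at `b` is `1`, and
  -- only `a < 2` matters: `a ≤ 1` uses `b ≥ 2a`, and otherwise `(2 - a) b ≤ 2 (b - a)`.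
  rcases le_or_gt b 2 with h | h
  · have : |min 1 (max 0 (a - 1)) - min 1 (max 0 (b - 1))| ≤ |a - b| := by
      have h1 : |min 1 (max 0 (a - 1)) - min 1 (max 0 (b - 1))| ≤
          |max 0 (a - 1) - max 0 (b - 1)| := by
        rw [min_comm 1, min_comm 1]; exact abs_min_sub_min_le_abs_sub _ _ _
      have h2 : |max 0 (a - 1) - max 0 (b - 1)| ≤ |(a - 1) - (b - 1)| := by
        rw [max_comm 0, max_comm 0]; exact abs_max_sub_max_le_abs _ _ _
      rw [sub_sub_sub_cancel_right] at h2
      exact h1.trans h2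
    nlinarith [abs_nonneg (a - b)]
  · have hb1 : min 1 (max 0 (b - 1)) = 1 := min_eq_left (le_max_of_le_right (by linarith))
    rw [hb1]
    rcases le_or_gt 2 a with h2 | h2
    · have ha1 : min 1 (max 0 (a - 1)) = 1 := min_eq_left (le_max_of_le_right (by linarith))
      rw [ha1, sub_self, abs_zero, zero_mul]; positivity
    · have hle : min 1 (max 0 (a - 1)) ≤ 1 := min_le_left _ _
      rw [abs_of_nonpos (by linarith), abs_of_nonpos (by linarith : a - b ≤ 0)]
      rcases le_or_gt a 1 with h3 | h3
      · rw [max_eq_left (by linarith), min_eq_right zero_le_one]; linarith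
      · rw [max_eq_right (by linarith), min_eq_right (by linarith)]; nlinarith

/-- The cutoff equal to `1` at distance at least `2 / n` from the complement of `Ω` and to `0` at
distance at most `1 / n`. -/
noncomputable def boundaryCutoff (Ω : Set (EuclideanSpace ℝ (Fin N))) (n : ℕ)
    (x : EuclideanSpace ℝ (Fin N)) : ℝ :=
  min 1 (max 0 (n * Metric.infDist x Ωᶜ - 1))

lemma boundaryCutoff_nonneg (Ω : Set (EuclideanSpace ℝ (Fin N))) (n : ℕ)
    (x : EuclideanSpace ℝ (Fin N)) : 0 ≤ boundaryCutoff Ω n x :=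
  le_min zero_le_one (le_max_left _ _)

lemma boundaryCutoff_le_one (Ω : Set (EuclideanSpace ℝ (Fin N))) (n : ℕ)
    (x : EuclideanSpace ℝ (Fin N)) : boundaryCutoff Ω n x ≤ 1 := min_le_left _ _

lemma measurable_boundaryCutoff (Ω : Set (EuclideanSpace ℝ (Fin N))) (n : ℕ) :
    Measurable (boundaryCutoff Ω n) := by
  have := Metric.continuous_infDist_pt Ωᶜ
  unfold boundaryCutoff
  exact Continuous.measurable (by fun_prop)

/-- The factor `n` cancels between numerator and denominator of the ramp estimate; the bound is
therefore uniform in `n`, as a common majorant requires. -/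
lemma abs_boundaryCutoff_sub_le (Ω : Set (EuclideanSpace ℝ (Fin N))) (n : ℕ)
    (x : EuclideanSpace ℝ (Fin N)) {y : EuclideanSpace ℝ (Fin N)}
    (hy : 0 < Metric.infDist y Ωᶜ) :
    |boundaryCutoff Ω n x - boundaryCutoff Ω n y| ≤
      min 1 (2 * ‖x - y‖ / Metric.infDist y Ωᶜ) := by
  refine le_min ?_ ?_
  · rw [abs_le]
    constructor <;> linarith [boundaryCutoff_nonneg Ω n x, boundaryCutoff_nonneg Ω n y,
      boundaryCutoff_le_one Ω n x, boundaryCutoff_le_one Ω n y]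
  rcases Nat.eq_zero_or_pos n with rfl | hn
  · simp only [boundaryCutoff, Nat.cast_zero, zero_mul, sub_self, abs_zero]
    positivity
  have hn' : (0 : ℝ) < n := by exact_mod_cast hn
  have hx : 0 ≤ Metric.infDist x Ωᶜ := Metric.infDist_nonneg
  have hlip := (Metric.lipschitz_infDist_pt Ωᶜ).dist_le_mul x y
  rw [Real.dist_eq, NNReal.coe_one, one_mul, dist_eq_norm] at hlip
  refine (abs_ramp_sub_le (by positivity) (by positivity)).trans ?_
  rw [← mul_sub, abs_mul, abs_of_pos hn']
  calc 2 * (n * |Metric.infDist x Ωᶜ - Metric.infDist y Ωᶜ|) / (n * Metric.infDist y Ωᶜ)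
      = 2 * |Metric.infDist x Ωᶜ - Metric.infDist y Ωᶜ| / Metric.infDist y Ωᶜ := by field_simp
    _ ≤ _ := by gcongr

/-- The truncations of `w`, both in height and near the boundary of `Ω`. -/
noncomputable def truncation (Ω : Set (EuclideanSpace ℝ (Fin N)))
    (w : EuclideanSpace ℝ (Fin N) → ℝ) (n : ℕ) (x : EuclideanSpace ℝ (Fin N)) : ℝ :=
  boundaryCutoff Ω n x * min (w x) n

/-- A common bound for the increments of all truncations. -/
noncomputable def truncationBound (Ω : Set (EuclideanSpace ℝ (Fin N)))
    (w : EuclideanSpace ℝ (Fin N) → ℝ)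
    (q : EuclideanSpace ℝ (Fin N) × EuclideanSpace ℝ (Fin N)) : ℝ :=
  |increment w q| + w q.2 * min 1 (2 * ‖q.1 - q.2‖ / Metric.infDist q.2 Ωᶜ)

section Truncation

variable {Ω : Set (EuclideanSpace ℝ (Fin N))} {w : EuclideanSpace ℝ (Fin N) → ℝ}

lemma measurable_truncation (hw : Measurable w) (n : ℕ) : Measurable (truncation Ω w n) :=
  (measurable_boundaryCutoff Ω n).mul (hw.min measurable_const)

lemma truncation_le_min (hw : ∀ x, 0 ≤ w x) (n : ℕ) (x : EuclideanSpace ℝ (Fin N)) :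
    truncation Ω w n x ≤ min (w x) n :=
  mul_le_of_le_one_left (le_min (hw x) n.cast_nonneg) (boundaryCutoff_le_one Ω n x)

lemma infDist_compl_pos (hΩ : IsOpen Ω) (hΩc : Ωᶜ.Nonempty) {x : EuclideanSpace ℝ (Fin N)}
    (hx : x ∈ Ω) : 0 < Metric.infDist x Ωᶜ :=
  (hΩ.isClosed_compl.notMem_iff_infDist_pos hΩc).1 (by simpa using hx)

/-- At each point of `Ω` the sequence is eventually constant, and outside `Ω` it is identically `0`.
-/
lemma tendsto_truncation (hΩ : IsOpen Ω) (hΩc : Ωᶜ.Nonempty) (hw0 : ∀ x ∉ Ω, w x = 0)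
    (x : EuclideanSpace ℝ (Fin N)) :
    Tendsto (fun n => truncation Ω w n x) atTop (𝓝 (w x)) := by
  by_cases hx : x ∈ Ω
  · have hd := infDist_compl_pos hΩ hΩc hx
    refine tendsto_const_nhds.congr' ?_
    filter_upwards [tendsto_natCast_atTop_atTop.eventually_ge_atTop (w x),
      tendsto_natCast_atTop_atTop.eventually_ge_atTop (2 / Metric.infDist x Ωᶜ)] with n h1 h2
    rw [div_le_iff₀ hd] at h2
    rw [truncation, boundaryCutoff, min_eq_left h1,
      min_eq_left (le_max_of_le_right (by linarith)), one_mul]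
  · refine tendsto_const_nhds.congr fun n => ?_
    rw [truncation, hw0 x hx, min_eq_left (by positivity), mul_zero]

lemma isCompact_setOf_le_mul_infDist (hΩb : Bornology.IsBounded Ω) (n : ℕ) :
    IsCompact {x | 1 ≤ n * Metric.infDist x Ωᶜ} ∧ {x | 1 ≤ n * Metric.infDist x Ωᶜ} ⊆ Ω := by
  have hsub : {x | 1 ≤ n * Metric.infDist x Ωᶜ} ⊆ Ω := by
    intro x hx
    by_contra h
    have h0 : Metric.infDist x Ωᶜ = 0 := Metric.infDist_zero_of_mem h
    simp only [mem_ofPred_eq, h0, mul_zero] at hx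
    linarith
  refine ⟨Metric.isCompact_of_isClosed_isBounded ?_ (hΩb.subset hsub), hsub⟩
  have := Metric.continuous_infDist_pt Ωᶜ
  exact isClosed_le continuous_const (by fun_prop)

lemma truncation_eq_zero {n : ℕ} {x : EuclideanSpace ℝ (Fin N)}
    (hx : x ∉ {x | 1 ≤ n * Metric.infDist x Ωᶜ}) : truncation Ω w n x = 0 := by
  rw [mem_ofPred_eq, not_le] at hx
  rw [truncation, boundaryCutoff, max_eq_left (by linarith), min_eq_right zero_le_one, zero_mul]

/-- A discrete product rule. The increment of the cutoff is paired with the value of `w` at the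
second point, whose distance to `Ωᶜ` is the one in the denominator; outside `Ω` that value is `0`.
-/
lemma abs_increment_truncation_le (hΩ : IsOpen Ω) (hΩc : Ωᶜ.Nonempty) (hw : ∀ x, 0 ≤ w x)
    (hw0 : ∀ x ∉ Ω, w x = 0) (n : ℕ)
    (q : EuclideanSpace ℝ (Fin N) × EuclideanSpace ℝ (Fin N)) :
    |increment (truncation Ω w n) q| ≤ truncationBound Ω w q := by
  have hm0 : 0 ≤ min (w q.2) n := le_min (hw _) n.cast_nonneg
  have e : increment (truncation Ω w n) q =
      boundaryCutoff Ω n q.1 * (min (w q.1) n - min (w q.2) n) +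
        min (w q.2) n * (boundaryCutoff Ω n q.1 - boundaryCutoff Ω n q.2) := by
    simp only [increment, truncation]; ring
  rw [e, truncationBound]
  refine (abs_add_le _ _).trans (add_le_add ?_ ?_)
  · rw [abs_mul, abs_of_nonneg (boundaryCutoff_nonneg Ω n _)]
    exact (mul_le_of_le_one_left (abs_nonneg _) (boundaryCutoff_le_one Ω n _)).trans
      (abs_min_sub_min_le_abs_sub _ _ _)
  · rw [abs_mul, abs_of_nonneg hm0]
    by_cases hy : q.2 ∈ Ω
    · exact mul_le_mul (min_le_left _ _)
        (abs_boundaryCutoff_sub_le Ω n q.1 (infDist_compl_pos hΩ hΩc hy)) (abs_nonneg _) (hw _)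
    · rw [hw0 _ hy, min_eq_left n.cast_nonneg, zero_mul, zero_mul]

/-- Integrating the second term first in `x`, the tempered kernel yields a multiple of `|w(y)|^p
d(y)^{-sp}`, which is integrable by the Hardy inequality. -/
lemma memLp_truncationBound (hN : 0 < N) {s p : ℝ} (hs0 : 0 < s) (hs1 : s < 1) (hp : 1 < p)
    (hΩ : IsOpen Ω) (hΩc : Ωᶜ.Nonempty) {κ : ℝ} (hκ : 0 < κ) (hext : ExteriorBallCondition κ Ω)
    (hwm : Measurable w) (hw0 : ∀ x ∉ Ω, w x = 0) (hwg : gagliardo s p univ w < ⊤) :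
    MemLp (truncationBound Ω w) (ENNReal.ofReal p) (kernelMeasure N s p) := by
  have hp0 : 0 < p := by linarith
  have hdc := Metric.continuous_infDist_pt Ωᶜ
  have hmin : Measurable fun q : EuclideanSpace ℝ (Fin N) × EuclideanSpace ℝ (Fin N) =>
      min 1 (2 * ‖q.1 - q.2‖ / Metric.infDist q.2 Ωᶜ) := by
    have hd : Measurable fun q : EuclideanSpace ℝ (Fin N) × EuclideanSpace ℝ (Fin N) =>
      Metric.infDist q.2 Ωᶜ := hdc.measurable.comp measurable_snd
    refine measurable_const.min (Measurable.div ?_ hd)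
    fun_prop
  have hm : Measurable fun q : EuclideanSpace ℝ (Fin N) × EuclideanSpace ℝ (Fin N) =>
      w q.2 * min 1 (2 * ‖q.1 - q.2‖ / Metric.infDist q.2 Ωᶜ) :=
    (hwm.comp measurable_snd).mul hmin
  refine ((memLp_increment_univ_iff hp0 hwm).2 hwg).norm.add ?_
  obtain ⟨C, hC, hCle⟩ := lintegral_tempered_kernel_le hN hs0 hs1 hp
  rw [memLp_ofReal_iff hp0 hm.aestronglyMeasurable,
    lintegral_kernelMeasure _ _ (hm.enorm.pow_const p), Measure.volume_eq_prod,
    lintegral_prod_symm _ (by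
      exact ((measurable_kernel s p).ennreal_ofReal.mul (hm.enorm.pow_const p)).aemeasurable)]
  have hhardy := lintegral_hardy hs0 hp hΩ hΩc hκ hext hwm hw0 hwg
  have hmd : Measurable fun x : EuclideanSpace ℝ (Fin N) =>
      ‖w x‖ₑ ^ p * ENNReal.ofReal (Metric.infDist x Ωᶜ ^ (-(s * p))) :=
    (hwm.enorm.pow_const p).mul (hdc.measurable.pow_const _).ennreal_ofReal
  refine lt_of_le_of_lt ?_ (ENNReal.mul_lt_top (lt_top_iff_ne_top.2 hC) hhardy)
  rw [← lintegral_const_mul _ hmd, ← lintegral_indicator hΩ.measurableSet]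
  refine lintegral_mono fun y => ?_
  by_cases hy : y ∈ Ω
  · rw [indicator_of_mem hy]
    have hd := infDist_compl_pos hΩ hΩc hy
    have hkm : Measurable fun x => ENNReal.ofReal (kernel s p (x, y)) *
        ENNReal.ofReal ((min 1 (2 * ‖x - y‖ / Metric.infDist y Ωᶜ)) ^ p) := by
      refine ((measurable_kernel s p).ennreal_ofReal.comp measurable_prodMk_right).mul ?_
      fun_prop
    calc _ = ∫⁻ x, ‖w y‖ₑ ^ p * (ENNReal.ofReal (kernel s p (x, y)) *
          ENNReal.ofReal ((min 1 (2 * ‖x - y‖ / Metric.infDist y Ωᶜ)) ^ p)) := by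
          refine lintegral_congr fun x => ?_
          have hnn : 0 ≤ min 1 (2 * ‖x - y‖ / Metric.infDist y Ωᶜ) := by positivity
          rw [enorm_mul, ENNReal.mul_rpow_of_nonneg _ _ hp0.le, enorm_rpow_eq_ofReal hp0
            (min 1 _), abs_of_nonneg hnn]
          ring
      _ = ‖w y‖ₑ ^ p * ∫⁻ x, (ENNReal.ofReal (kernel s p (x, y)) *
          ENNReal.ofReal ((min 1 (2 * ‖x - y‖ / Metric.infDist y Ωᶜ)) ^ p)) :=
          lintegral_const_mul _ hkm
      _ ≤ ‖w y‖ₑ ^ p * (C * ENNReal.ofReal (Metric.infDist y Ωᶜ ^ (-(s * p)))) := by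
          gcongr; exact hCle y _ hd
      _ = _ := by ring
  · rw [indicator_of_notMem hy]
    refine le_of_eq ?_
    simp [hw0 y hy, hp0]

lemma gagliardo_truncation_lt_top (hN : 0 < N) {s p : ℝ} (hs0 : 0 < s) (hs1 : s < 1) (hp : 1 < p)
    (hΩ : IsOpen Ω) (hΩc : Ωᶜ.Nonempty) {κ : ℝ} (hκ : 0 < κ) (hext : ExteriorBallCondition κ Ω)
    (hwm : Measurable w) (hw : ∀ x, 0 ≤ w x) (hw0 : ∀ x ∉ Ω, w x = 0)
    (hwg : gagliardo s p univ w < ⊤) (n : ℕ) :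
    gagliardo s p univ (truncation Ω w n) < ⊤ := by
  rw [← memLp_increment_univ_iff (by linarith) (measurable_truncation hwm n)]
  exact (memLp_truncationBound hN hs0 hs1 hp hΩ hΩc hκ hext hwm hw0 hwg).mono'
    (measurable_increment (measurable_truncation hwm n)).aestronglyMeasurable
    (Eventually.of_forall (abs_increment_truncation_le hΩ hΩc hw hw0 n))

end Truncation

/-! ### Independence of the chosen representatives. -/

lemma ae_fst_snd_eq {z z' : EuclideanSpace ℝ (Fin N) → ℝ} (h : z =ᵐ[volume] z') :
    ∀ᵐ q : EuclideanSpace ℝ (Fin N) × EuclideanSpace ℝ (Fin N), z q.1 = z' q.1 ∧ z q.2 = z' q.2 := by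
  rw [Measure.volume_eq_prod]
  filter_upwards [Measure.quasiMeasurePreserving_fst.ae h,
    Measure.quasiMeasurePreserving_snd.ae h] with q h1 h2
  exact ⟨h1, h2⟩

lemma gagliardo_congr_ae {s p : ℝ} (A : Set (EuclideanSpace ℝ (Fin N)))
    {z z' : EuclideanSpace ℝ (Fin N) → ℝ} (h : z =ᵐ[volume] z') :
    gagliardo s p A z = gagliardo s p A z' := by
  refine lintegral_congr_ae (ae_restrict_of_ae ?_)
  filter_upwards [ae_fst_snd_eq h] with q hq
  rw [hq.1, hq.2]

lemma formIntegrand_congr_ae {s p : ℝ} {z z' : EuclideanSpace ℝ (Fin N) → ℝ}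
    (h : z =ᵐ[volume] z') (φ : EuclideanSpace ℝ (Fin N) → ℝ) :
    formIntegrand s p z φ =ᵐ[volume] formIntegrand s p z' φ := by
  filter_upwards [ae_fst_snd_eq h] with q hq
  rw [formIntegrand, formIntegrand, hq.1, hq.2]

lemma singularTerm_congr_ae {γ : ℝ} (f : EuclideanSpace ℝ (Fin N) → ℝ)
    {z z' : EuclideanSpace ℝ (Fin N) → ℝ} (h : z =ᵐ[volume] z') :
    singularTerm γ f z =ᵐ[volume] singularTerm γ f z' := by
  filter_upwards [h] with x hx
  rw [singularTerm, singularTerm, hx]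

lemma IsAdmissible.congr_ae {s p γ : ℝ} {Ω : Set (EuclideanSpace ℝ (Fin N))}
    {f z z' : EuclideanSpace ℝ (Fin N) → ℝ} (hz : IsAdmissible s p γ Ω f z)
    (h : z =ᵐ[volume] z') : IsAdmissible s p γ Ω f z' where
  aemeasurable := hz.aemeasurable.congr h
  nonneg := by
    filter_upwards [hz.nonneg, h] with x h1 h2
    rwa [← h2]
  memWloc K hK hKΩ := ⟨(hz.memWloc K hK hKΩ).1.ae_eq (ae_restrict_of_ae h),
    gagliardo_congr_ae K h ▸ (hz.memWloc K hK hKΩ).2⟩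
  memLp := hz.memLp.ae_eq (ae_restrict_of_ae h)
  locallyIntegrable_singularTerm K hK hKΩ := by
    rw [← lintegral_congr_ae (ae_restrict_of_ae (singularTerm_congr_ae f h))]
    exact hz.locallyIntegrable_singularTerm K hK hKΩ
  integrable_form φ hφ := (hz.integrable_form φ hφ).congr (formIntegrand_congr_ae h φ)

lemma setIntegral_singularTerm_congr_ae {γ : ℝ} (Ω : Set (EuclideanSpace ℝ (Fin N)))
    (f φ : EuclideanSpace ℝ (Fin N) → ℝ) {z z' : EuclideanSpace ℝ (Fin N) → ℝ}
    (h : z =ᵐ[volume] z') :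
    ∫ x in Ω, (singularTerm γ f z x).toReal * φ x =
      ∫ x in Ω, (singularTerm γ f z' x).toReal * φ x := by
  refine integral_congr_ae (ae_restrict_of_ae ?_)
  filter_upwards [singularTerm_congr_ae (γ := γ) f h] with x hx
  rw [hx]

lemma IsWeakSubsolution.congr_ae {s p γ : ℝ} {Ω : Set (EuclideanSpace ℝ (Fin N))}
    {f z z' : EuclideanSpace ℝ (Fin N) → ℝ} (hz : IsWeakSubsolution s p γ Ω f z)
    (h : z =ᵐ[volume] z') : IsWeakSubsolution s p γ Ω f z' := by
  refine ⟨hz.1.congr_ae h, fun φ hφ => ?_⟩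
  rw [← integral_congr_ae (formIntegrand_congr_ae h φ),
    ← setIntegral_singularTerm_congr_ae Ω f φ h]
  exact hz.2 φ hφ

lemma IsWeakSupersolution.congr_ae {s p γ : ℝ} {Ω : Set (EuclideanSpace ℝ (Fin N))}
    {f z z' : EuclideanSpace ℝ (Fin N) → ℝ} (hz : IsWeakSupersolution s p γ Ω f z)
    (h : z =ᵐ[volume] z') : IsWeakSupersolution s p γ Ω f z' := by
  refine ⟨hz.1.congr_ae h, fun φ hφ => ?_⟩
  rw [← integral_congr_ae (formIntegrand_congr_ae h φ),
    ← setIntegral_singularTerm_congr_ae Ω f φ h]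
  exact hz.2 φ hφ

/-! ### The comparison argument. -/

/-- Cutting `u` at height `ε` decreases the form tested with functions supported in `{u > ε}`. -/
lemma signedPow_posPart_mul_le {p : ℝ} (hp : 1 < p) {a b ε α β : ℝ} (hα : 0 ≤ α) (hβ : 0 ≤ β)
    (hαa : 0 < α → ε < a) (hβb : 0 < β → ε < b) :
    signedPow p (max (a - ε) 0 - max (b - ε) 0) * (α - β) ≤ signedPow p (a - b) * (α - β) := by
  have hmono := (signedPow_strictMono hp).monotone
  -- If both values exceed `ε`, cutting keeps their difference. If exactly one does, the weight at
  -- the other point is `0`, and cutting moves `a - b` towards `0`, which has the favourable sign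
  -- against `α - β`.
  rcases le_or_gt a ε with ha | ha
  · have hα0 : α = 0 := le_antisymm (not_lt.1 fun h => (hαa h).not_ge ha) hα
    rcases le_or_gt b ε with hb | hb
    · have hβ0 : β = 0 := le_antisymm (not_lt.1 fun h => (hβb h).not_ge hb) hβ
      simp [hα0, hβ0]
    · have : signedPow p (a - b) ≤ signedPow p (max (a - ε) 0 - max (b - ε) 0) := by
        refine hmono ?_
        rw [max_eq_right (by linarith), max_eq_left (by linarith)]; linarith
      exact mul_le_mul_of_nonpos_right this (by linarith)
  · rcases le_or_gt b ε with hb | hb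
    · have hβ0 : β = 0 := le_antisymm (not_lt.1 fun h => (hβb h).not_ge hb) hβ
      have : signedPow p (max (a - ε) 0 - max (b - ε) 0) ≤ signedPow p (a - b) := by
        refine hmono ?_
        rw [max_eq_left (by linarith), max_eq_right (by linarith)]; linarith
      exact mul_le_mul_of_nonneg_right this (by linarith)
    · rw [max_eq_left (by linarith), max_eq_left (by linarith), sub_sub_sub_cancel_right]

lemma singularTerm_le_of_le {γ : ℝ} (hγ : 0 < γ) {f u v : EuclideanSpace ℝ (Fin N) → ℝ}
    {x : EuclideanSpace ℝ (Fin N)} (h : v x ≤ u x) : singularTerm γ f u x ≤ singularTerm γ f v x :=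
  ENNReal.div_le_div_left (ENNReal.rpow_le_rpow (ENNReal.ofReal_le_ofReal h) hγ.le) _

/-- The form evaluated at a supersolution dominates the form evaluated at the cut subsolution, for
test functions supported where the subsolution is the larger one. -/
lemma integral_form_cut_le (hN : 0 < N) {s p γ : ℝ} (hs0 : 0 < s) (hs1 : s < 1) (hp : 1 < p)
    (hγ : 0 < γ) {Ω K : Set (EuclideanSpace ℝ (Fin N))} (hΩ : IsOpen Ω) (hK : IsCompact K)
    (hKΩ : K ⊆ Ω) {f u v : EuclideanSpace ℝ (Fin N) → ℝ} (hf : IntegrableOn f Ω volume)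
    (hu : IsWeakSubsolution s p γ Ω f u) (hv : IsWeakSupersolution s p γ Ω f v)
    (hum : Measurable u) (hvm : Measurable v) (hv0 : ∀ x, 0 ≤ v x) {ε : ℝ} (hε : 0 < ε)
    (hw : gagliardo s p univ (fun x => max (u x - ε) 0) < ⊤)
    {ψ : EuclideanSpace ℝ (Fin N) → ℝ} (hψ : Measurable ψ) (hψ0 : ∀ x, 0 ≤ ψ x) {M : ℝ}
    (hM : ∀ x, ψ x ≤ M) (hψK : ∀ x ∉ K, ψ x = 0) (hψg : gagliardo s p univ ψ < ⊤)
    (hψuv : ∀ x, 0 < ψ x → v x + ε < u x) :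
    Integrable (fun q => signedPow p (increment v q) * increment ψ q) (kernelMeasure N s p) ∧
    ∫ q, signedPow p (increment (fun x => max (u x - ε) 0) q) * increment ψ q
        ∂kernelMeasure N s p ≤
      ∫ q, signedPow p (increment v q) * increment ψ q ∂kernelMeasure N s p := by
  have hp0 : 0 < p := by linarith
  obtain ⟨hui, hus, φ, hφ, hφ1, hφ2⟩ :=
    hu.1.exists_nonnegTest_seq hN hs0 hs1 hp hΩ hK hKΩ hf hum hψ hψ0 hM hψK hψg
  obtain ⟨hvi, hvs, φ', hφ', hφ'1, hφ'2⟩ :=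
    hv.1.exists_nonnegTest_seq hN hs0 hs1 hp hΩ hK hKΩ hf hvm hψ hψ0 hM hψK hψg
  have h1 := le_of_tendsto_of_tendsto' hφ1 hφ2 fun k => hu.2 (φ k) (hφ k)
  have h2 := le_of_tendsto_of_tendsto' hφ'2 hφ'1 fun k => hv.2 (φ' k) (hφ' k)
  have hwm : Measurable fun x => max (u x - ε) 0 := (hum.sub_const ε).max measurable_const
  refine ⟨hvi, ?_⟩
  have h3 : ∫ q, signedPow p (increment (fun x => max (u x - ε) 0) q) * increment ψ q
      ∂kernelMeasure N s p ≤ ∫ q, signedPow p (increment u q) * increment ψ q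
        ∂kernelMeasure N s p := by
    refine integral_mono (integrable_signedPow_mul hp ((memLp_increment_univ_iff hp0 hwm).2 hw)
      ((memLp_increment_univ_iff hp0 hψ).2 hψg)) hui fun q => ?_
    refine signedPow_posPart_mul_le hp (hψ0 _) (hψ0 _) (fun h => ?_) (fun h => ?_)
    · linarith [hψuv _ h, hv0 q.1]
    · linarith [hψuv _ h, hv0 q.2]
  have h4 : ∫ x in Ω, (singularTerm γ f u x).toReal * ψ x ≤
      ∫ x in Ω, (singularTerm γ f v x).toReal * ψ x := by
    -- Finiteness is needed because `toReal` sends `∞` to `0` and would break the monotonicity; it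
    -- follows from local integrability at `v`.
    have hfin : ∀ᵐ x, x ∈ K → singularTerm γ f v x < ⊤ := by
      rw [← ae_restrict_iff' hK.measurableSet]
      exact ae_lt_top' ((aemeasurable_singularTerm hf hvm).mono_measure
        (Measure.restrict_mono hKΩ le_rfl)) (hv.1.locallyIntegrable_singularTerm K hK hKΩ).ne
    refine integral_mono_ae hus hvs (ae_restrict_of_ae ?_)
    filter_upwards [hfin] with x hx
    rcases (hψ0 x).eq_or_lt with h | h
    · simp only [← h, mul_zero, le_refl]
    · have hxK : x ∈ K := by
        by_contra hn
        exact h.ne' (hψK x hn)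
      refine mul_le_mul_of_nonneg_right (ENNReal.toReal_mono (hx hxK).ne ?_) (hψ0 x)
      exact singularTerm_le_of_le hγ (by linarith [hψuv x h])
  exact h3.trans (h1.trans (h4.trans h2))

/-- Two functions on the whole space, one of which vanishes outside `Ω`, are ordered on `Ω` as soon
as the monotonicity of the form degenerates on the positive part of their difference. -/
lemma ae_le_of_ae_signedPow_sub_mul_nonpos {s p : ℝ} (hp : 1 < p)
    {Ω : Set (EuclideanSpace ℝ (Fin N))} (hΩ : MeasurableSet Ω) (hΩc : volume Ωᶜ ≠ 0)
    {w v : EuclideanSpace ℝ (Fin N) → ℝ} (hw0 : ∀ x ∉ Ω, w x = 0) (hv : ∀ x, 0 ≤ v x)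
    (h : ∀ᵐ q ∂kernelMeasure N s p, (signedPow p (increment w q) - signedPow p (increment v q)) *
      increment (fun x => max (w x - v x) 0) q ≤ 0) :
    ∀ᵐ x ∂volume.restrict Ω, w x ≤ v x := by
  rw [kernelMeasure, ae_withDensity_iff (measurable_kernel s p).ennreal_ofReal, ae_iff] at h
  -- For `y ∉ Ω` the increment of `w` is `w(x)`, that of `v` is at most `v(x) < w(x)`, and that of
  -- the positive part is `w(x) - v(x) > 0`. Hence the product is strictly positive.
  have hsub : {x | x ∈ Ω ∧ v x < w x} ×ˢ Ωᶜ ⊆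
      {q : EuclideanSpace ℝ (Fin N) × EuclideanSpace ℝ (Fin N) |
        ¬(ENNReal.ofReal (kernel s p q) ≠ 0 →
          (signedPow p (increment w q) - signedPow p (increment v q)) *
            increment (fun x => max (w x - v x) 0) q ≤ 0)} := by
    rintro ⟨x, y⟩ ⟨⟨hx, hxw⟩, hy⟩
    rw [mem_ofPred_eq, Classical.not_imp, not_le]
    have hxy : 0 < ‖x - y‖ := by
      rw [norm_pos_iff, sub_ne_zero]
      rintro rfl
      exact hy hx
    refine ⟨?_, ?_⟩
    · rw [Ne, ENNReal.ofReal_eq_zero, not_le, kernel]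
      positivity
    · simp only [increment, hw0 y hy, zero_sub, sub_zero]
      rw [max_eq_left (by linarith), max_eq_right (by linarith [hv y])]
      refine mul_pos (sub_pos.2 (signedPow_strictMono hp ?_)) (by linarith)
      linarith [hv y]
  have hnull := measure_mono_null hsub h
  rw [Measure.volume_eq_prod, Measure.prod_prod, mul_eq_zero] at hnull
  have hS := hnull.resolve_right hΩc
  rw [ae_restrict_iff' hΩ, ae_iff]
  refine measure_mono_null (fun x hx => ?_) hS
  rw [mem_ofPred_eq, Classical.not_imp, not_le] at hx
  exact hx

/-- The comparison principle for everywhere nonnegative measurable representatives. -/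
lemma ae_le_of_measurable (hN : 0 < N) {s p γ : ℝ} (hs0 : 0 < s) (hs1 : s < 1) (hp : 1 < p)
    (hγ : 0 < γ) {Ω : Set (EuclideanSpace ℝ (Fin N))} (hΩ : IsSmoothBoundedDomain Ω)
    {f u v : EuclideanSpace ℝ (Fin N) → ℝ} (hf : IntegrableOn f Ω volume)
    (hu : IsWeakSubsolution s p γ Ω f u) (hv : IsWeakSupersolution s p γ Ω f v)
    (hum : Measurable u) (hvm : Measurable v) (huΩ : ∀ x ∉ Ω, u x = 0) (hv0 : ∀ x, 0 ≤ v x)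
    (hug : ∀ ε : ℝ, 0 < ε → gagliardo s p univ (fun x => max (u x - ε) 0) < ⊤) :
    ∀ᵐ x ∂volume.restrict Ω, u x ≤ v x := by
  have hp0 : 0 < p := by linarith
  have hΩc := hΩ.compl_nonempty hN
  obtain ⟨κ, hκ, hext⟩ := hΩ.exists_exteriorBallCondition hN
  have hΩc0 : volume Ωᶜ ≠ 0 := by
    obtain ⟨x, hx⟩ := hΩ.isConnected.nonempty
    obtain ⟨y, hy, -⟩ := hext x hx
    have := infDist_compl_pos hΩ.isOpen hΩc hx
    exact fun h0 => (Metric.measure_ball_pos volume y (by positivity)).ne' (measure_mono_null hy h0)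
  have key : ∀ ε : ℝ, 0 < ε → ∀ᵐ x ∂volume.restrict Ω, u x - ε ≤ v x := by
    intro ε hε
    set w : EuclideanSpace ℝ (Fin N) → ℝ := fun x => max (u x - ε) 0 with hw
    have hwm : Measurable w := (hum.sub_const ε).max measurable_const
    have hwnn : ∀ x, 0 ≤ w x := fun x => le_max_right _ _
    have hw0 : ∀ x ∉ Ω, w x = 0 := fun x hx => by
      simp only [hw, huΩ x hx]; exact max_eq_right (by linarith)
    have hwg : gagliardo s p univ w < ⊤ := hug ε hε
    -- Only `w` is truncated: since `v ≥ 0`, the positive part inherits the height bound `n` and the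
    -- compact support of the truncation.
    set ψ : ℕ → EuclideanSpace ℝ (Fin N) → ℝ := fun n x => max (truncation Ω w n x - v x) 0 with hψ
    have htm := fun n => measurable_truncation (Ω := Ω) hwm n
    have hψm : ∀ n, Measurable (ψ n) := fun n => ((htm n).sub hvm).max measurable_const
    have hψn : ∀ n x, ψ n x ≤ n := by
      intro n x
      refine max_le ?_ n.cast_nonneg
      have := (truncation_le_min (Ω := Ω) hwnn n x).trans (min_le_right _ _)
      linarith [hv0 x]
    have hψK : ∀ n : ℕ, ∀ x ∉ {x | 1 ≤ n * Metric.infDist x Ωᶜ}, ψ n x = 0 := by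
      intro n x hx
      simp only [hψ, truncation_eq_zero hx]
      exact max_eq_right (by linarith [hv0 x])
    have hψg : ∀ n, gagliardo s p univ (ψ n) < ⊤ := by
      intro n
      obtain ⟨hK, hKΩ⟩ := isCompact_setOf_le_mul_infDist hΩ.isBounded n
      exact gagliardo_posPart_sub_lt_top hN hs0 hs1 hp hΩ.isOpen hK hKΩ (htm n) hvm
        (gagliardo_truncation_lt_top hN hs0 hs1 hp hΩ.isOpen hΩc hκ hext hwm hwnn hw0 hwg n)
        hv.1.memWloc (hψn n) (hψK n)
    have hψuv : ∀ n x, 0 < ψ n x → v x + ε < u x := by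
      intro n x hx
      have h1 : v x < truncation Ω w n x := by
        by_contra! h
        exact hx.ne' (max_eq_right (by linarith))
      have h2 : v x < w x :=
        h1.trans_le ((truncation_le_min (Ω := Ω) hwnn n x).trans (min_le_left _ _))
      rcases lt_max_iff.1 h2 with h3 | h3
      · linarith
      · exact absurd h3 (hv0 x).not_gt
    have hcut := fun n => integral_form_cut_le hN hs0 hs1 hp hγ hΩ.isOpen
      (isCompact_setOf_le_mul_infDist hΩ.isBounded n).1
      (isCompact_setOf_le_mul_infDist hΩ.isBounded n).2 hf hu hv hum hvm hv0 hε hwg (hψm n)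
      (fun x => le_max_right _ _) (hψn n) (hψK n) (hψg n) (hψuv n)
    have htlim := fun x => tendsto_truncation hΩ.isOpen hΩc hw0 x
    obtain ⟨C, hC, hcoer⟩ := signedPow_coercive hp
    have hψlim : ∀ x, Tendsto (fun n => ψ n x) atTop (𝓝 (max (w x - v x) 0)) := fun x =>
      ((htlim x).sub_const _).max tendsto_const_nhds
    have hmain := ae_signedPow_sub_mul_nonpos hp (U := increment w) (V := increment v)
      (Ψ := increment fun x => max (w x - v x) 0) (Un := fun n => increment (truncation Ω w n))
      (Ψn := fun n => increment (ψ n)) (measurable_increment hvm)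
      (fun n => measurable_increment (htm n)) (fun n => measurable_increment (hψm n))
      (memLp_truncationBound hN hs0 hs1 hp hΩ.isOpen hΩc hκ hext hwm hw0 hwg)
      (abs_increment_truncation_le hΩ.isOpen hΩc hwnn hw0)
      (fun q => (htlim q.1).sub (htlim q.2)) (fun q => (hψlim q.1).sub (hψlim q.2))
      (fun n => (memLp_increment_univ_iff hp0 (hψm n)).2 (hψg n)) (fun n => (hcut n).1) hC
      (fun n q => (hcoer _ _ _ _).1) (fun n q => (hcoer _ _ _ _).2) (fun n => (hcut n).2)
    filter_upwards [ae_le_of_ae_signedPow_sub_mul_nonpos hp hΩ.isOpen.measurableSet hΩc0 hw0 hv0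
      hmain] with x hx
    exact (le_max_left _ _).trans hx
  have hall : ∀ᵐ x ∂volume.restrict Ω, ∀ n : ℕ, u x - 1 / ((n : ℝ) + 1) ≤ v x :=
    ae_all_iff.2 fun n => key _ (by positivity)
  filter_upwards [hall] with x hx
  have hlim : Tendsto (fun n : ℕ => u x - 1 / ((n : ℝ) + 1)) atTop (𝓝 (u x - 0)) :=
    tendsto_one_div_add_atTop_nhds_zero_nat.const_sub (u x)
  rw [sub_zero] at hlim
  exact le_of_tendsto' hlim hx

end FracPLap

theorem theorem4p2 {N : ℕ} (s p γ : ℝ) (hs0 : 0 < s) (hs1 : s < 1) (hp : 1 < p)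
    (hN : s * p < N) (hγ : 0 < γ)
    (Ω : Set (EuclideanSpace ℝ (Fin N))) (hΩ : FracPLap.IsSmoothBoundedDomain Ω)
    (f : EuclideanSpace ℝ (Fin N) → ℝ) (hf : IntegrableOn f Ω volume)
    (hf0 : ∀ᵐ x ∂(volume.restrict Ω), 0 ≤ f x)
    (u v : EuclideanSpace ℝ (Fin N) → ℝ)
    (hu : FracPLap.IsWeakSubsolution s p γ Ω f u)
    (hu0 : FracPLap.NonposOnBoundary s p Ω u)
    (hv : FracPLap.IsWeakSupersolution s p γ Ω f v) :
    ∀ᵐ x ∂(volume.restrict Ω), u x ≤ v x := by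
  have hN0 : 0 < N := by
    have : (0 : ℝ) < N := lt_trans (by positivity) hN
    exact_mod_cast this
  -- These measurable representatives satisfy the exterior condition on `u` and the sign condition
  -- on `v` everywhere, not only a.e.
  set u' : EuclideanSpace ℝ (Fin N) → ℝ := Ω.indicator (hu.1.aemeasurable.mk u)
  set v' : EuclideanSpace ℝ (Fin N) → ℝ := fun x => max (hv.1.aemeasurable.mk v x) 0
  have hum : Measurable u' := hu.1.aemeasurable.measurable_mk.indicator hΩ.isOpen.measurableSet
  have hvm : Measurable v' := hv.1.aemeasurable.measurable_mk.max measurable_const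
  have huu' : u =ᵐ[volume] u' := by
    filter_upwards [hu.1.aemeasurable.ae_eq_mk, hu0.1] with x h1 h2
    by_cases hx : x ∈ Ω
    · rw [h1]; exact (indicator_of_mem hx _).symm
    · rw [h2 hx]; exact (indicator_of_notMem hx _).symm
  have hvv' : v =ᵐ[volume] v' := by
    filter_upwards [hv.1.aemeasurable.ae_eq_mk, hv.1.nonneg] with x h1 h2
    rw [h1] at h2
    rw [h1]; exact (max_eq_left h2).symm
  have h := FracPLap.ae_le_of_measurable hN0 hs0 hs1 hp hγ hΩ hf (hu.congr_ae huu')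
    (hv.congr_ae hvv') hum hvm (fun x hx => indicator_of_notMem hx _) (fun x => le_max_right _ _)
    fun ε hε =>
      (FracPLap.gagliardo_congr_ae univ (huu'.fun_comp fun t => max (t - ε) 0)).symm.trans_lt
        (hu0.2 ε hε).gagliardo_lt_top
  filter_upwards [h, ae_restrict_of_ae huu', ae_restrict_of_ae hvv'] with x h1 h2 h3
  rw [h2, h3]; exact h1
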